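/- Let $\mathbb{D}=\{z\in\mathbb{C}:|z|<1\}$ and $\mathbb{T}=\partial\mathbb{D}$. A *majorant* is a continuous non-decreasing function $\omega:[0,\infty)\to[0,\infty)$ with $\omega(0)=0$ such that $\omega(t)/t$ is non-increasing on $(0,\infty)$. For $\Omega\subseteq\mathbb{C}$, $\mathscr{L}_\omega(\Omega)$ denotes the set of functions $h:\Omega\to\mathbb{C}$ for which there is a constant $C>0$ with $|h(z_1)-h(z_2)|\le C\,\omega(|z_1-z_2|)$ for all $z_1,z_2\in\Omega$. Write $\partial_{\bar z}=\frac12\left(\frac{\partial}{\partial x}+i\frac{\partial}{\partial y}\right)$ and $\Delta=\frac{\partial^2}{\partial x^2}+\frac{\partial^2}{\partial y^2}$. Let $\omega_1,\omega_2$ be majorants, not both identically zero, and suppose that there is a constant $C>0$ such that $$\lambda\int_\lambda^\pi\frac{\omega_2(t)}{t^2}\,dt\le C\,\omega_2(\lambda)\qquad\text{for all }\lambda\in(0,\pi].$$ Let $g:\overline{\mathbb{D}}\to\mathbb{C}$ be continuous, $\varphi\in\mathscr{L}_{\omega_1}(\mathbb{T})$ and $\psi\in\mathscr{L}_{\omega_2}(\mathbb{T})$.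 Suppose that $f:\mathbb{D}\to\mathbb{C}$ is four times continuously differentiable (in the real sense) and satisfies $$\Delta(\Delta f)=g\ \text{ in }\mathbb{D},\qquad \partial_{\bar z}f=\varphi\ \text{ on }\mathbb{T},\qquad f=\psi\ \text{ on }\mathbb{T},$$ where the boundary conditions mean that $\partial_{\bar z}f(z)\to\varphi(\zeta)$ and $f(z)\to\psi(\zeta)$ as $z\to\zeta$, $z\in\mathbb{D}$, for every $\zeta\in\mathbb{T}$. Then there is a constant $M>0$ such that $$|f(z_1)-f(z_2)|\le M\,\omega_1(|z_1-z_2|)+M\,\omega_2(|z_1-z_2|)\qquad\text{for all }z_1,z_2\in\mathbb{D}.$$ -/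

import Mathlib

open scoped Topology Laplacian

namespace BiharmonicDirichlet

/-- A majorant: a continuous increasing function `ω : [0, ∞) → [0, ∞)` with `ω 0 = 0` such that
`ω t / t` is non-increasing on `(0, ∞)`. The values of `ω` at negative numbers play no role. -/
structure IsMajorant (ω : ℝ → ℝ) : Prop where
  continuousOn : ContinuousOn ω (Set.Ici 0)
  monotoneOn : MonotoneOn ω (Set.Ici 0)
  map_zero : ω 0 = 0
  antitoneOn_div : AntitoneOn (fun t => ω t / t) (Set.Ioi 0)

/-- The Hardy–Littlewood condition `lam * ∫_lam^π ω(t) / t² dt ≤ M * ω(lam)` for all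
`lam ∈ (0, π]`, with some constant `M > 0`. -/
def HardyLittlewoodCondition (ω : ℝ → ℝ) : Prop :=
  ∃ M : ℝ, 0 < M ∧ ∀ lam : ℝ, 0 < lam → lam ≤ Real.pi →
    lam * (∫ t in lam..Real.pi, ω t / t ^ 2) ≤ M * ω lam

/-- `f` (restricted to `Ω`) belongs to the Lipschitz space of the majorant `ω` on `Ω ⊆ ℂ`. -/
def MemLipschitzSpace (ω : ℝ → ℝ) (Ω : Set ℂ) (f : ℂ → ℂ) : Prop :=
  ∃ M : ℝ, 0 < M ∧ ∀ z₁ ∈ Ω, ∀ z₂ ∈ Ω, ‖f z₁ - f z₂‖ ≤ M * ω ‖z₁ - z₂‖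

/-- The Wirtinger derivative `∂f/∂z̄ = (1/2) (∂f/∂x + i ∂f/∂y)`. -/
noncomputable def dZBar (f : ℂ → ℂ) (z : ℂ) : ℂ :=
  (1 / 2 : ℂ) * (fderiv ℝ f z 1 + Complex.I * fderiv ℝ f z Complex.I)

/-- `u = h` on the unit circle, for a function `u` on the open unit disk: at every point `ζ` of the
unit circle, `u z` tends to `h ζ` as `z` tends to `ζ` from within the disk. -/
def HasBoundaryValues (u h : ℂ → ℂ) : Prop :=
  ∀ ζ ∈ Metric.sphere (0 : ℂ) 1, Filter.Tendsto u (𝓝[Metric.ball (0 : ℂ) 1] ζ) (𝓝 (h ζ))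

/-- `f` is a `C⁴` function on the open unit disk with `Δ(Δf) = g` there, and with `∂f/∂z̄ = φ` and
`f = ψ` on the unit circle. -/
structure IsSolution (g φ ψ f : ℂ → ℂ) : Prop where
  contDiffOn : ContDiffOn ℝ 4 f (Metric.ball (0 : ℂ) 1)
  equation : ∀ z ∈ Metric.ball (0 : ℂ) 1, Δ (Δ f) z = g z
  boundary_dZBar : HasBoundaryValues (dZBar f) φ
  boundary_value : HasBoundaryValues f ψ

end BiharmonicDirichlet

/-! By compactness, `f` and `∂f/∂z̄` are bounded on the disk, since they are continuous there and
have a limit at every boundary point; `∂²∂̄²f = g/16` is bounded as well.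

The heart is the boundary estimate `|f(ζρ) - ψ(ζ)| ≤ C (ω₂(1-ρ) + (1-ρ))`, in
`exists_norm_sub_boundary_le`. Let `σ` be the disk automorphism `mobius (-ζ) ρ`, which takes `0` to
`ζρ`. For `F = (f ∘ σ)/|σ'|` one has `∂²∂̄²F = |σ'|³ (∂²∂̄²f) ∘ σ`, without lower-order terms
(`bilaplacian_bolTransform`). If `∂²∂̄²F = 0`, then `F - ū ∂̄F` has mean `F(0)` on circles about
`0`; `norm_circleCoeff_sub_le` gives this with a remainder. Multiplied by `1-ρ²`, the integrand
becomes `(1-ρu) f(σ(u))` up to `O(1-ρ)`, because `∂̄f` is bounded. So `f(ζρ) - ψ(ζ)` is, up to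
`O(1-ρ)`, the mean of `(1-ρu)(ψ(σ(u)) - ψ(ζ))` on the unit circle. There `|σ(u) - ζ|` is at most a
constant times `d / max(|θ|, d)` with `d = 1-ρ`, and the substitution `t ↦ πd/t` leads to the
Hardy–Littlewood integral.

Inside the disk, `norm_dZ_le` bounds `∂f` by the oscillation of `f` on a small ball. With the
boundary estimate this gives `|∇f(z)| = O(W(d)/d)`, where `d = 1-|z|` and `W(t) = ω₂(t) + t`. Close
points are joined by a segment, other pairs are compared through the boundary
(`exists_lipschitz_of_boundary`). The extra term `t` is absorbed at the end: a majorant that is not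
identically zero dominates a multiple of `t` on `[0, 2]`. -/

namespace BiharmonicDirichlet

open Complex Set Metric Filter

/-! ### Wirtinger calculus -/

/-- The Wirtinger derivative `∂f/∂z = (1/2) (∂f/∂x - i ∂f/∂y)`. -/
noncomputable def dZ (f : ℂ → ℂ) (z : ℂ) : ℂ :=
  (1 / 2 : ℂ) * (fderiv ℝ f z 1 - Complex.I * fderiv ℝ f z Complex.I)

/-- The real-linear map `w ↦ p w + q conj w`. -/
noncomputable def wirtingerCLM (p q : ℂ) : ℂ →L[ℝ] ℂ :=
  p • ContinuousLinearMap.id ℝ ℂ + q • (conjCLE : ℂ →L[ℝ] ℂ)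

theorem wirtingerCLM_apply (p q w : ℂ) :
    wirtingerCLM p q w = p * w + q * (starRingEnd ℂ) w := by
  simp [wirtingerCLM]

/-- `f` is real-differentiable at `z` with Wirtinger derivatives `p = ∂f/∂z`, `q = ∂f/∂z̄`. -/
def HasWirtinger (f : ℂ → ℂ) (p q z : ℂ) : Prop := HasFDerivAt f (wirtingerCLM p q) z

theorem clm_eq_wirtingerCLM (L : ℂ →L[ℝ] ℂ) :
    L = wirtingerCLM ((1 / 2 : ℂ) * (L 1 - I * L I)) ((1 / 2 : ℂ) * (L 1 + I * L I)) := by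
  ext w
  rw [wirtingerCLM_apply]
  have h : L w = w.re • L 1 + w.im • L I := by
    rw [← L.map_smul, ← L.map_smul, ← L.map_add]
    congr 1
    apply Complex.ext <;> simp
  have h1 : w = w.re + w.im * I := (re_add_im w).symm
  have h2 : (starRingEnd ℂ) w = w.re - w.im * I := by
    apply Complex.ext <;> simp
  rw [h, h2]
  nth_rewrite 3 [h1]
  simp only [real_smul]
  linear_combination ((w.im : ℂ) * L I) * I_sq

theorem hasWirtinger_of_differentiableAt {f : ℂ → ℂ} {z : ℂ} (h : DifferentiableAt ℝ f z) :
    HasWirtinger f (dZ f z) (dZBar f z) z := by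
  have := h.hasFDerivAt
  rw [clm_eq_wirtingerCLM (fderiv ℝ f z)] at this
  exact this

theorem HasWirtinger.dZ_eq {f : ℂ → ℂ} {p q z : ℂ} (h : HasWirtinger f p q z) : dZ f z = p := by
  unfold dZ
  rw [HasFDerivAt.fderiv h, wirtingerCLM_apply, wirtingerCLM_apply]
  simp only [map_one, conj_I]
  linear_combination (-(1 / 2) * p + (1 / 2) * q) * I_sq

theorem HasWirtinger.dZBar_eq {f : ℂ → ℂ} {p q z : ℂ} (h : HasWirtinger f p q z) :
    dZBar f z = q := by
  unfold dZBar
  rw [HasFDerivAt.fderiv h, wirtingerCLM_apply, wirtingerCLM_apply]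
  simp only [map_one, conj_I]
  linear_combination ((1 / 2) * p - (1 / 2) * q) * I_sq

theorem HasWirtinger.congr {f : ℂ → ℂ} {p q p' q' z : ℂ} (h : HasWirtinger f p q z)
    (hp : p = p') (hq : q = q') : HasWirtinger f p' q' z := by
  subst hp hq; exact h

theorem HasWirtinger.mul {f g : ℂ → ℂ} {p q p' q' z : ℂ} (hf : HasWirtinger f p q z)
    (hg : HasWirtinger g p' q' z) :
    HasWirtinger (fun z => f z * g z) (p * g z + f z * p') (q * g z + f z * q') z := by
  have := HasFDerivAt.mul (𝕜 := ℝ) hf hg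
  refine this.congr_fderiv (ContinuousLinearMap.ext fun w => ?_)
  simp [wirtingerCLM_apply]
  ring

theorem HasWirtinger.add {f g : ℂ → ℂ} {p q p' q' z : ℂ} (hf : HasWirtinger f p q z)
    (hg : HasWirtinger g p' q' z) :
    HasWirtinger (fun z => f z + g z) (p + p') (q + q') z := by
  have := HasFDerivAt.add (𝕜 := ℝ) hf hg
  refine this.congr_fderiv (ContinuousLinearMap.ext fun w => ?_)
  simp [wirtingerCLM_apply]
  ring

theorem HasWirtinger.comp_holomorphic {f s : ℂ → ℂ} {p q s' z : ℂ}
    (hf : HasWirtinger f p q (s z)) (hs : HasDerivAt s s' z) :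
    HasWirtinger (fun z => f (s z)) (p * s') (q * (starRingEnd ℂ) s') z := by
  have h1 : HasFDerivAt s ((ContinuousLinearMap.toSpanSingleton ℂ s').restrictScalars ℝ) z :=
    hs.hasFDerivAt.restrictScalars ℝ
  have := HasFDerivAt.comp z hf h1
  refine this.congr_fderiv (ContinuousLinearMap.ext fun w => ?_)
  simp [wirtingerCLM_apply]
  ring

theorem hasWirtinger_id (z : ℂ) : HasWirtinger (fun z => z) 1 0 z := by
  refine (hasFDerivAt_id z).congr_fderiv (ContinuousLinearMap.ext fun w => ?_)
  simp [wirtingerCLM_apply]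

theorem hasWirtinger_of_hasDerivAt {s : ℂ → ℂ} {s' z : ℂ} (hs : HasDerivAt s s' z) :
    HasWirtinger s s' 0 z := by
  simpa using (hasWirtinger_id (s z)).comp_holomorphic hs

theorem hasWirtinger_conj (z : ℂ) : HasWirtinger (fun z => (starRingEnd ℂ) z) 0 1 z := by
  refine (conjCLE.hasFDerivAt (x := z)).congr_fderiv (ContinuousLinearMap.ext fun w => ?_)
  simp [wirtingerCLM_apply]

theorem HasWirtinger.holomorphic_comp {f s : ℂ → ℂ} {p q s' z : ℂ}
    (hf : HasWirtinger f p q z) (hs : HasDerivAt s s' (f z)) :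
    HasWirtinger (fun z => s (f z)) (s' * p) (s' * q) z := by
  have h1 : HasFDerivAt s ((ContinuousLinearMap.toSpanSingleton ℂ s').restrictScalars ℝ) (f z) :=
    hs.hasFDerivAt.restrictScalars ℝ
  have := HasFDerivAt.comp z h1 hf
  refine this.congr_fderiv (ContinuousLinearMap.ext fun w => ?_)
  simp [wirtingerCLM_apply]
  ring

theorem contDiffOn_dZ {f : ℂ → ℂ} {U : Set ℂ} {n m : WithTop ℕ∞} (hU : IsOpen U)
    (hf : ContDiffOn ℝ n f U) (hmn : m + 1 ≤ n) : ContDiffOn ℝ m (dZ f) U := by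
  have h := hf.fderiv_of_isOpen hU hmn
  exact contDiffOn_const.mul ((h.clm_apply contDiffOn_const).sub
    (contDiffOn_const.mul (h.clm_apply contDiffOn_const)))

theorem contDiffOn_dZBar {f : ℂ → ℂ} {U : Set ℂ} {n m : WithTop ℕ∞} (hU : IsOpen U)
    (hf : ContDiffOn ℝ n f U) (hmn : m + 1 ≤ n) : ContDiffOn ℝ m (dZBar f) U := by
  have h := hf.fderiv_of_isOpen hU hmn
  exact contDiffOn_const.mul ((h.clm_apply contDiffOn_const).add
    (contDiffOn_const.mul (h.clm_apply contDiffOn_const)))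

theorem dZ_congr {f g : ℂ → ℂ} {z : ℂ} (h : f =ᶠ[𝓝 z] g) : dZ f z = dZ g z := by
  unfold dZ; rw [h.fderiv_eq]

theorem dZBar_congr {f g : ℂ → ℂ} {z : ℂ} (h : f =ᶠ[𝓝 z] g) : dZBar f z = dZBar g z := by
  unfold dZBar; rw [h.fderiv_eq]

theorem fderiv_dZ_apply {f : ℂ → ℂ} {z : ℂ} (hf : ContDiffAt ℝ 2 f z) (w : ℂ) :
    fderiv ℝ (dZ f) z w =
      (1 / 2 : ℂ) * (fderiv ℝ (fderiv ℝ f) z w 1 - I * fderiv ℝ (fderiv ℝ f) z w I) := by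
  have hd : DifferentiableAt ℝ (fderiv ℝ f) z :=
    (hf.fderiv_right (m := 1) (by norm_num)).differentiableAt (by norm_num)
  have h1 : ∀ v : ℂ, HasFDerivAt (fun z => fderiv ℝ f z v) ((fderiv ℝ (fderiv ℝ f) z).flip v) z :=
    fun v => by
    refine (HasFDerivAt.clm_apply hd.hasFDerivAt (hasFDerivAt_const v z)).congr_fderiv ?_
    refine ContinuousLinearMap.ext fun w => ?_
    simp
  have := (((h1 1).sub ((h1 I).const_mul I)).const_mul (1 / 2 : ℂ)).fderiv
  unfold dZ
  erw [this]
  simp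

theorem fderiv_dZBar_apply {f : ℂ → ℂ} {z : ℂ} (hf : ContDiffAt ℝ 2 f z) (w : ℂ) :
    fderiv ℝ (dZBar f) z w =
      (1 / 2 : ℂ) * (fderiv ℝ (fderiv ℝ f) z w 1 + I * fderiv ℝ (fderiv ℝ f) z w I) := by
  have hd : DifferentiableAt ℝ (fderiv ℝ f) z :=
    (hf.fderiv_right (m := 1) (by norm_num)).differentiableAt (by norm_num)
  have h1 : ∀ v : ℂ, HasFDerivAt (fun z => fderiv ℝ f z v) ((fderiv ℝ (fderiv ℝ f) z).flip v) z :=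
    fun v => by
    refine (HasFDerivAt.clm_apply hd.hasFDerivAt (hasFDerivAt_const v z)).congr_fderiv ?_
    refine ContinuousLinearMap.ext fun w => ?_
    simp
  have := (((h1 1).add ((h1 I).const_mul I)).const_mul (1 / 2 : ℂ)).fderiv
  unfold dZBar
  erw [this]
  simp [mul_add]

theorem laplacian_eq_dZBar_dZ {f : ℂ → ℂ} {z : ℂ} (hf : ContDiffAt ℝ 2 f z) :
    Δ f z = 4 * dZBar (dZ f) z := by
  have hs : fderiv ℝ (fderiv ℝ f) z 1 I = fderiv ℝ (fderiv ℝ f) z I 1 :=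
    (hf.isSymmSndFDerivAt (by simp)) 1 I
  rw [InnerProductSpace.laplacian_eq_iteratedFDeriv_complexPlane]
  simp only [iteratedFDeriv_two_apply, dZBar, fderiv_dZ_apply hf]
  simp only [Matrix.cons_val_zero, Matrix.cons_val_one]
  linear_combination I * hs + fderiv ℝ (fderiv ℝ f) z I I * I_sq

theorem dZ_dZBar_comm {f : ℂ → ℂ} {z : ℂ} (hf : ContDiffAt ℝ 2 f z) :
    dZ (dZBar f) z = dZBar (dZ f) z := by
  have hs : fderiv ℝ (fderiv ℝ f) z 1 I = fderiv ℝ (fderiv ℝ f) z I 1 :=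
    (hf.isSymmSndFDerivAt (by simp)) 1 I
  unfold dZ
  rw [← show dZ f = fun z => (1 / 2 : ℂ) * (fderiv ℝ f z 1 - I * fderiv ℝ f z I) from rfl]
  rw [dZBar]
  simp only [fderiv_dZ_apply hf, fderiv_dZBar_apply hf]
  linear_combination (1 / 2) * I * hs

/-! ### Fourier coefficients on circles -/

/-- The (unnormalised) `n`-th Fourier coefficient of `u` on the circle `|z - c| = r`. -/
noncomputable def circleCoeff (c : ℂ) (n : ℤ) (u : ℂ → ℂ) (r : ℝ) : ℂ :=
  ∫ θ in -Real.pi..Real.pi, exp (-(n : ℂ) * θ * I) * u (circleMap c r θ)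

theorem circleMap_mem_ball_of_abs_lt {c : ℂ} {r R : ℝ} (h : |r| < R) (θ : ℝ) :
    circleMap c r θ ∈ ball c R := by
  rw [mem_ball, Complex.dist_eq, circleMap_sub_center, norm_circleMap_zero]
  exact h

theorem norm_exp_coeff (n : ℤ) (θ : ℝ) : ‖exp (-(n : ℂ) * θ * I)‖ = 1 := by
  have : -(n : ℂ) * θ * I = ((-(n : ℝ) * θ : ℝ) : ℂ) * I := by push_cast; ring
  rw [this, norm_exp_ofReal_mul_I]

theorem continuous_comp_circleMap {c : ℂ} {R r : ℝ} {v : ℂ → ℂ} (hv : ContinuousOn v (ball c R))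
    (hr : |r| < R) : Continuous fun θ : ℝ => v (circleMap c r θ) :=
  hv.comp_continuous (continuous_circleMap c r) (circleMap_mem_ball_of_abs_lt hr)

theorem continuous_coeff_integrand {c : ℂ} {R r : ℝ} {v : ℂ → ℂ} (n : ℤ)
    (hv : ContinuousOn v (ball c R)) (hr : |r| < R) :
    Continuous fun θ : ℝ => exp (-(n : ℂ) * θ * I) * v (circleMap c r θ) :=
  (by fun_prop : Continuous fun θ : ℝ => exp (-(n : ℂ) * θ * I)).mul
    (continuous_comp_circleMap hv hr)

theorem exp_coeff_mul_exp (n : ℤ) (θ : ℝ) :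
    exp (-(n : ℂ) * θ * I) * exp (θ * I) = exp (-((n - 1 : ℤ) : ℂ) * θ * I) := by
  rw [← Complex.exp_add]; congr 1; push_cast; ring

theorem exp_coeff_mul_conj_exp (n : ℤ) (θ : ℝ) :
    exp (-(n : ℂ) * θ * I) * (starRingEnd ℂ) (exp (θ * I)) = exp (-((n + 1 : ℤ) : ℂ) * θ * I) := by
  rw [← exp_conj, ← Complex.exp_add]; congr 1; push_cast
  simp only [map_mul, conj_ofReal, conj_I]; ring

theorem hasDerivAt_comp_real {u : ℂ → ℂ} {p q z : ℂ} {γ : ℝ → ℂ} {γ' : ℂ} {t : ℝ}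
    (hγ : HasDerivAt γ γ' t) (hz : γ t = z) (hu : HasWirtinger u p q z) :
    HasDerivAt (fun t => u (γ t)) (p * γ' + q * (starRingEnd ℂ) γ') t := by
  subst hz
  have := HasFDerivAt.comp_hasDerivAt t hu hγ
  rw [wirtingerCLM_apply] at this
  exact this

theorem norm_circleCoeff_le {c : ℂ} {n : ℤ} {v : ℂ → ℂ} {r M : ℝ}
    (h : ∀ θ : ℝ, ‖v (circleMap c r θ)‖ ≤ M) : ‖circleCoeff c n v r‖ ≤ 2 * Real.pi * M := by
  have := intervalIntegral.norm_integral_le_of_norm_le_const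
    (a := -Real.pi) (b := Real.pi) (C := M)
    (f := fun θ : ℝ => exp (-(n : ℂ) * θ * I) * v (circleMap c r θ)) (fun θ _ => by
      rw [norm_mul, norm_exp_coeff, one_mul]; exact h θ)
  refine this.trans (le_of_eq ?_)
  rw [abs_of_nonneg (by linarith [Real.pi_pos])]; ring

/-- Differentiation under the integral of `∂u/∂r = e^{iθ} ∂u + e^{-iθ} ∂̄u`; the two exponentials
shift the index by one. Since `|r| < R` allows negative `r`, the derivative is two-sided at `r = 0`.
-/
theorem hasDerivAt_circleCoeff {c : ℂ} {R : ℝ} {u : ℂ → ℂ} (hu : ContDiffOn ℝ 1 u (ball c R))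
    (n : ℤ) {r : ℝ} (hr : |r| < R) :
    HasDerivAt (circleCoeff c n u)
      (circleCoeff c (n - 1) (dZ u) r + circleCoeff c (n + 1) (dZBar u) r) r := by
  have hp : ContinuousOn (dZ u) (ball c R) :=
    (contDiffOn_dZ (m := 0) isOpen_ball hu (by norm_num)).continuousOn
  have hq : ContinuousOn (dZBar u) (ball c R) :=
    (contDiffOn_dZBar (m := 0) isOpen_ball hu (by norm_num)).continuousOn
  obtain ⟨ρ, hrρ, hρR⟩ := exists_between hr
  have hsub : closedBall c ρ ⊆ ball c R := closedBall_subset_ball hρR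
  obtain ⟨A, hA⟩ := (isCompact_closedBall c ρ).exists_bound_of_continuousOn (hp.mono hsub)
  obtain ⟨B, hB⟩ := (isCompact_closedBall c ρ).exists_bound_of_continuousOn (hq.mono hsub)
  have hmem : ∀ x ∈ ball (0 : ℝ) ρ, |x| < ρ := fun x hx => by simpa using hx
  have hder : ∀ x, |x| < R → ∀ θ : ℝ, HasDerivAt
      (fun x : ℝ => exp (-(n : ℂ) * θ * I) * u (circleMap c x θ))
      (exp (-((n - 1 : ℤ) : ℂ) * θ * I) * dZ u (circleMap c x θ) +
        exp (-((n + 1 : ℤ) : ℂ) * θ * I) * dZBar u (circleMap c x θ)) x := by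
    intro x hx θ
    have h1 : HasDerivAt (fun x : ℝ => circleMap c x θ) (exp (θ * I)) x := by
      unfold circleMap
      simpa using ((ofRealCLM.hasDerivAt (x := x)).mul_const (exp (θ * I))).const_add c
    have hd : DifferentiableAt ℝ u (circleMap c x θ) :=
      (hu.differentiableOn (by norm_num)).differentiableAt
        (isOpen_ball.mem_nhds (circleMap_mem_ball_of_abs_lt hx θ))
    have := (hasDerivAt_comp_real h1 rfl (hasWirtinger_of_differentiableAt hd)).const_mul
      (exp (-(n : ℂ) * θ * I))
    refine this.congr_deriv ?_
    rw [← exp_coeff_mul_exp, ← exp_coeff_mul_conj_exp]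
    ring
  have key := intervalIntegral.hasDerivAt_integral_of_dominated_loc_of_deriv_le
    (μ := MeasureTheory.volume) (a := -Real.pi) (b := Real.pi)
    (F := fun (x : ℝ) (θ : ℝ) => exp (-(n : ℂ) * θ * I) * u (circleMap c x θ))
    (F' := fun (x : ℝ) (θ : ℝ) => exp (-((n - 1 : ℤ) : ℂ) * θ * I) * dZ u (circleMap c x θ) +
        exp (-((n + 1 : ℤ) : ℂ) * θ * I) * dZBar u (circleMap c x θ))
    (x₀ := r) (s := ball (0 : ℝ) ρ) (bound := fun _ => A + B)
    (isOpen_ball.mem_nhds (by simpa using hrρ)) ?_ ?_ ?_ ?_ ?_ ?_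
  · have h2 := key.2
    rw [intervalIntegral.integral_add
      ((continuous_coeff_integrand _ hp hr).intervalIntegrable _ _)
      ((continuous_coeff_integrand _ hq hr).intervalIntegrable _ _)] at h2
    exact h2
  · filter_upwards [isOpen_ball.mem_nhds (show r ∈ ball (0 : ℝ) R by simpa using hr)] with x hx
    exact (continuous_coeff_integrand n hu.continuousOn (by simpa using hx)).aestronglyMeasurable
  · exact (continuous_coeff_integrand n hu.continuousOn hr).intervalIntegrable _ _
  · exact ((continuous_coeff_integrand _ hp hr).add
      (continuous_coeff_integrand _ hq hr)).aestronglyMeasurable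
  · refine Eventually.of_forall fun θ _ x hx => ?_
    have hx' : circleMap c x θ ∈ closedBall c ρ :=
      ball_subset_closedBall (circleMap_mem_ball_of_abs_lt (hmem x hx) θ)
    refine (norm_add_le _ _).trans (add_le_add ?_ ?_)
    · rw [norm_mul, norm_exp_coeff, one_mul]; exact hA _ hx'
    · rw [norm_mul, norm_exp_coeff, one_mul]; exact hB _ hx'
  · exact intervalIntegrable_const
  · exact Eventually.of_forall fun θ _ x hx => hder x ((hmem x hx).trans hρR) θ

/-- Integration by parts in `θ`, from `∂u/∂θ = ir (e^{iθ} ∂u - e^{-iθ} ∂̄u)`. Combined with the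
radial derivative it eliminates one of the two Wirtinger derivatives, leaving first-order equations
in `r` that can be integrated one after another. -/
theorem mul_circleCoeff {c : ℂ} {R : ℝ} {u : ℂ → ℂ} (hu : ContDiffOn ℝ 1 u (ball c R))
    (n : ℤ) {r : ℝ} (hr : |r| < R) :
    (n : ℂ) * circleCoeff c n u r =
      r * (circleCoeff c (n - 1) (dZ u) r - circleCoeff c (n + 1) (dZBar u) r) := by
  have hp : ContinuousOn (dZ u) (ball c R) :=
    (contDiffOn_dZ (m := 0) isOpen_ball hu (by norm_num)).continuousOn
  have hq : ContinuousOn (dZBar u) (ball c R) :=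
    (contDiffOn_dZBar (m := 0) isOpen_ball hu (by norm_num)).continuousOn
  have hder : ∀ θ : ℝ, HasDerivAt
      (fun θ : ℝ => exp (-(n : ℂ) * θ * I) * u (circleMap c r θ))
      (-(n : ℂ) * I * (exp (-(n : ℂ) * θ * I) * u (circleMap c r θ)) +
        r * I * (exp (-((n - 1 : ℤ) : ℂ) * θ * I) * dZ u (circleMap c r θ) -
        exp (-((n + 1 : ℤ) : ℂ) * θ * I) * dZBar u (circleMap c r θ))) θ := by
    intro θ
    have h0 : HasDerivAt (fun θ : ℝ => exp (-(n : ℂ) * θ * I))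
        (exp (-(n : ℂ) * θ * I) * (-(n : ℂ) * I)) θ := by
      have := (((ofRealCLM.hasDerivAt (x := θ)).const_mul (-(n : ℂ))).mul_const I).cexp
      simpa using this
    have hd : DifferentiableAt ℝ u (circleMap c r θ) :=
      (hu.differentiableOn (by norm_num)).differentiableAt
        (isOpen_ball.mem_nhds (circleMap_mem_ball_of_abs_lt hr θ))
    have := h0.mul (hasDerivAt_comp_real (hasDerivAt_circleMap c r θ) rfl
      (hasWirtinger_of_differentiableAt hd))
    refine this.congr_deriv ?_
    rw [← exp_coeff_mul_exp, ← exp_coeff_mul_conj_exp]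
    simp only [circleMap, zero_add, map_mul, conj_ofReal, conj_I]
    ring
  have hc := (continuous_coeff_integrand n hu.continuousOn hr)
  have hcp := (continuous_coeff_integrand (n - 1) hp hr)
  have hcq := (continuous_coeff_integrand (n + 1) hq hr)
  have hint := intervalIntegral.integral_eq_sub_of_hasDerivAt (a := -Real.pi) (b := Real.pi)
    (fun θ _ => hder θ)
    (Continuous.intervalIntegrable ((continuous_const.mul hc).add
      (continuous_const.mul (hcp.sub hcq))) _ _)
  have hend : exp (-(n : ℂ) * (Real.pi : ℝ) * I) * u (circleMap c r Real.pi) =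
      exp (-(n : ℂ) * ((-Real.pi : ℝ) : ℂ) * I) * u (circleMap c r (-Real.pi)) := by
    have h1 : circleMap c r Real.pi = circleMap c r (-Real.pi) := by
      rw [← periodic_circleMap c r (-Real.pi)]; congr 1; ring
    have h2 : exp (-(n : ℂ) * ((-Real.pi : ℝ) : ℂ) * I) = exp (-(n : ℂ) * (Real.pi : ℝ) * I) := by
      rw [Complex.exp_eq_exp_iff_exists_int]
      exact ⟨n, by push_cast; ring⟩
    rw [h1, h2]
  have i1 : IntervalIntegrable (fun θ : ℝ => -(n : ℂ) * I * (exp (-(n : ℂ) * θ * I) *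
      u (circleMap c r θ))) MeasureTheory.volume (-Real.pi) Real.pi :=
    (continuous_const.mul hc).intervalIntegrable _ _
  have i2 : IntervalIntegrable (fun θ : ℝ => r * I * (exp (-((n - 1 : ℤ) : ℂ) * θ * I) *
      dZ u (circleMap c r θ) - exp (-((n + 1 : ℤ) : ℂ) * θ * I) * dZBar u (circleMap c r θ)))
      MeasureTheory.volume (-Real.pi) Real.pi :=
    (continuous_const.mul (hcp.sub hcq)).intervalIntegrable _ _
  rw [hend, sub_self, intervalIntegral.integral_add i1 i2,
    intervalIntegral.integral_const_mul, intervalIntegral.integral_const_mul,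
    intervalIntegral.integral_sub (hcp.intervalIntegrable _ _) (hcq.intervalIntegrable _ _)] at hint
  change -(n : ℂ) * I * circleCoeff c n u r + r * I * (circleCoeff c (n - 1) (dZ u) r -
    circleCoeff c (n + 1) (dZBar u) r) = 0 at hint
  have hI := I_ne_zero
  apply mul_left_cancel₀ hI
  linear_combination -hint

theorem circleCoeff_zero_radius (c : ℂ) (u : ℂ → ℂ) :
    circleCoeff c 0 u 0 = 2 * Real.pi * u c := by
  simp only [circleCoeff, circleMap, Int.cast_zero, neg_zero, zero_mul, Complex.exp_zero, one_mul,
    ofReal_zero, add_zero, intervalIntegral.integral_const, real_smul]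
  push_cast
  ring

theorem circleCoeff_const (c : ℂ) {n : ℤ} (hn : n ≠ 0) (a : ℂ) (r : ℝ) :
    circleCoeff c n (fun _ => a) r = 0 := by
  have h := mul_circleCoeff (c := c) (R := |r| + 1) (u := fun _ => a) contDiffOn_const n
    (lt_add_one _)
  have h1 : dZ (fun _ => a) = fun _ => 0 := by ext z; simp [dZ]
  have h2 : dZBar (fun _ => a) = fun _ => 0 := by ext z; simp [dZBar]
  rw [h1, h2] at h
  simpa [circleCoeff, hn] using h

theorem circleCoeff_zero_radius_of_ne (c : ℂ) (u : ℂ → ℂ) {n : ℤ} (hn : n ≠ 0) :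
    circleCoeff c n u 0 = 0 := by
  have := circleCoeff_const c hn (u c) 0
  simpa [circleCoeff, circleMap] using this

theorem circleCoeff_sub {c : ℂ} {R r : ℝ} {u v : ℂ → ℂ} (n : ℤ) (hu : ContinuousOn u (ball c R))
    (hv : ContinuousOn v (ball c R)) (hr : |r| < R) :
    circleCoeff c n (fun z => u z - v z) r = circleCoeff c n u r - circleCoeff c n v r := by
  unfold circleCoeff
  rw [← intervalIntegral.integral_sub ((continuous_coeff_integrand n hu hr).intervalIntegrable _ _)
    ((continuous_coeff_integrand n hv hr).intervalIntegrable _ _)]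
  congr 1; ext θ; ring

/-- `(u_0)' = 2 (∂u/∂z̄)_1`. -/
theorem hasDerivAt_circleCoeff_zero {c : ℂ} {R : ℝ} {u : ℂ → ℂ} (hu : ContDiffOn ℝ 1 u (ball c R))
    {r : ℝ} (hr : |r| < R) :
    HasDerivAt (circleCoeff c 0 u) (2 * circleCoeff c 1 (dZBar u) r) r := by
  have h := hasDerivAt_circleCoeff hu 0 hr
  have h2 := mul_circleCoeff hu 0 hr
  refine h.congr_deriv ?_
  rw [show (0 : ℤ) - 1 = -1 from rfl, show (0 : ℤ) + 1 = 1 from rfl] at *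
  rcases eq_or_ne r 0 with rfl | h0
  · rw [circleCoeff_zero_radius_of_ne _ _ (by norm_num),
      circleCoeff_zero_radius_of_ne _ _ (by norm_num)]; simp
  · have h0' : (r : ℂ) ≠ 0 := by exact_mod_cast h0
    have h3 : circleCoeff c (-1) (dZ u) r - circleCoeff c 1 (dZBar u) r = 0 := by
      apply mul_left_cancel₀ h0'
      rw [← h2]; simp
    linear_combination h3

/-- `(r^n u_n)' = 2 r^n (∂u/∂z)_{n-1}` for `n ≥ 1`. -/
theorem hasDerivAt_pow_mul_circleCoeff {c : ℂ} {R : ℝ} {u : ℂ → ℂ}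
    (hu : ContDiffOn ℝ 1 u (ball c R)) (n : ℕ) {r : ℝ} (hr : |r| < R) :
    HasDerivAt (fun r : ℝ => (r : ℂ) ^ (n + 1) * circleCoeff c (n + 1) u r)
      (2 * r ^ (n + 1) * circleCoeff c n (dZ u) r) r := by
  have h := hasDerivAt_circleCoeff hu (n + 1) hr
  have h2 := mul_circleCoeff hu (n + 1) hr
  have h1 : HasDerivAt (fun r : ℝ => (r : ℂ) ^ (n + 1)) ((n + 1) * (r : ℂ) ^ n) r := by
    have := (ofRealCLM.hasDerivAt (x := r)).fun_pow (n + 1)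
    simpa using this
  refine (h1.mul h).congr_deriv ?_
  rw [show (n : ℤ) + 1 - 1 = n by ring] at *
  push_cast at h2
  linear_combination (r : ℂ) ^ n * h2

/-! ### Interior gradient estimate -/

theorem norm_le_of_norm_deriv_le {X X' : ℝ → ℂ} {B B' : ℝ → ℝ} {s : ℝ} (hs : 0 ≤ s)
    (hX : ∀ r ∈ Icc 0 s, HasDerivAt X (X' r) r) (hB : ∀ r ∈ Icc 0 s, HasDerivAt B (B' r) r)
    (h0 : ‖X 0‖ ≤ B 0) (h : ∀ r ∈ Icc 0 s, ‖X' r‖ ≤ B' r) : ‖X s‖ ≤ B s :=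
  image_norm_le_of_norm_deriv_right_le_deriv_boundary'
    (fun r hr => (hX r hr).continuousAt.continuousWithinAt)
    (fun r hr => (hX r (Ico_subset_Icc_self hr)).hasDerivWithinAt) h0
    (fun r hr => (hB r hr).continuousAt.continuousWithinAt)
    (fun r hr => (hB r (Ico_subset_Icc_self hr)).hasDerivWithinAt)
    (fun r hr => h r (Ico_subset_Icc_self hr)) (right_mem_Icc.2 hs)

theorem hasDerivAt_ofReal_pow (n : ℕ) (r : ℝ) :
    HasDerivAt (fun r : ℝ => (r : ℂ) ^ (n + 1)) ((n + 1) * (r : ℂ) ^ n) r := by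
  have := (ofRealCLM.hasDerivAt (x := r)).fun_pow (n + 1)
  simpa using this

theorem hasDerivAt_const_mul_pow (C : ℝ) (n : ℕ) (r : ℝ) :
    HasDerivAt (fun r : ℝ => C * r ^ (n + 1)) (C * ((n + 1) * r ^ n)) r := by
  have := ((hasDerivAt_id r).fun_pow (n + 1)).const_mul C
  simpa using this

/-- Interior estimate: the Wirtinger derivative at the centre of a ball is controlled by the
oscillation and the bilaplacian. -/
theorem norm_dZ_le {f : ℂ → ℂ} {c : ℂ} {s R A γ : ℝ} (hs : 0 < s) (hsR : s < R)
    (hf : ContDiffOn ℝ 4 f (ball c R)) (hA : ∀ z ∈ ball c R, ‖f z - f c‖ ≤ A)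
    (hγ : ∀ z ∈ ball c R, ‖dZBar (dZ (dZBar (dZ f))) z‖ ≤ γ) :
    ‖dZ f c‖ ≤ 3 * A / s + γ * s ^ 3 := by
  have hR : 0 < R := hs.trans hsR
  have hπ := Real.pi_pos
  have hp : ContDiffOn ℝ 3 (dZ f) (ball c R) := contDiffOn_dZ isOpen_ball hf (by norm_num)
  have hk : ContDiffOn ℝ 2 (dZBar (dZ f)) (ball c R) :=
    contDiffOn_dZBar isOpen_ball hp (by norm_num)
  have hm : ContDiffOn ℝ 1 (dZ (dZBar (dZ f))) (ball c R) :=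
    contDiffOn_dZ isOpen_ball hk (by norm_num)
  have hγ0 : 0 ≤ γ := (norm_nonneg _).trans (hγ c (mem_ball_self hR))
  have hlt : ∀ {r t : ℝ}, t ≤ s → r ∈ Icc 0 t → |r| < R := fun ht hr => by
    rw [abs_of_nonneg hr.1]; exact (hr.2.trans ht).trans_lt hsR
  set k := dZBar (dZ f)
  set m := dZ k
  set c₁ := circleCoeff c 0 (dZ f) 0 with hc₁
  set c₃ := circleCoeff c 0 m 0
  -- Four successive radial integrations starting from the bound on `∂̄m`. They end with `t f_1(t) =
  -- c₁ t² + (c₃/2) t⁴ + O(γ t⁵)`, where `c₁ = 2π ∂f(c)` and `c₃ = 2π m(c)`.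
  have e₁ : ∀ t ∈ Icc 0 s, ‖circleCoeff c 0 m t - c₃‖ ≤ 4 * Real.pi * γ * t ^ (0 + 1) := by
    intro t ht
    refine norm_le_of_norm_deriv_le ht.1 (X := fun t => circleCoeff c 0 m t - c₃)
      (fun r hr => (hasDerivAt_circleCoeff_zero hm (hlt ht.2 hr)).sub_const c₃)
      (fun r _ => hasDerivAt_const_mul_pow _ 0 r) (by simp [c₃]) (fun r hr => ?_)
    have := norm_circleCoeff_le (n := 1) (fun θ => hγ _ (circleMap_mem_ball_of_abs_lt
      (hlt ht.2 hr) θ))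
    rw [norm_mul, Complex.norm_ofNat]
    push_cast
    linarith
  have e₂ : ∀ t ∈ Icc 0 s, ‖(t : ℂ) ^ (0 + 1) * circleCoeff c ((0 : ℕ) + 1) k t - c₃ * t ^ (1 + 1)‖
      ≤ 8 / 3 * Real.pi * γ * t ^ (2 + 1) := by
    intro t ht
    refine norm_le_of_norm_deriv_le ht.1
      (X := fun t : ℝ => (t : ℂ) ^ (0 + 1) * circleCoeff c ((0 : ℕ) + 1) k t - c₃ * t ^ (1 + 1))
      (fun r hr => (hasDerivAt_pow_mul_circleCoeff (hk.of_le (by norm_num)) 0 (hlt ht.2 hr)).sub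
        ((hasDerivAt_ofReal_pow 1 r).const_mul c₃))
      (fun r _ => hasDerivAt_const_mul_pow _ 2 r) (by simp) (fun r hr => ?_)
    have := e₁ r ⟨hr.1, hr.2.trans ht.2⟩
    have h2 : 2 * (r : ℂ) ^ (0 + 1) * circleCoeff c (0 : ℕ) m r -
        c₃ * (((1 : ℕ) + 1) * (r : ℂ) ^ 1) = (2 * r : ℝ) * (circleCoeff c 0 m r - c₃) := by
      push_cast; ring
    rw [h2, norm_mul, norm_real, Real.norm_of_nonneg (by linarith [hr.1])]
    have h3 := mul_le_mul_of_nonneg_left this (show 0 ≤ 2 * r by linarith [hr.1])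
    refine h3.trans (le_of_eq ?_)
    push_cast; ring
  have e₂' : ∀ t ∈ Icc 0 s, ‖circleCoeff c 1 k t - c₃ * t‖ ≤ 8 / 3 * Real.pi * γ * t ^ 2 := by
    intro t ht
    rcases ht.1.eq_or_lt with rfl | h0
    · simp [circleCoeff_zero_radius_of_ne]
    · have := e₂ t ht
      have h2 : (t : ℂ) ^ (0 + 1) * circleCoeff c ((0 : ℕ) + 1) k t - c₃ * t ^ (1 + 1) =
          t * (circleCoeff c 1 k t - c₃ * t) := by
        simp only [Nat.cast_zero, zero_add]; ring
      rw [h2, norm_mul, norm_real, Real.norm_of_nonneg ht.1] at this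
      refine le_of_mul_le_mul_left (this.trans (le_of_eq ?_)) h0
      ring
  have e₃ : ∀ t ∈ Icc 0 s, ‖circleCoeff c 0 (dZ f) t - c₁ - c₃ * t ^ (1 + 1)‖
      ≤ 16 / 9 * Real.pi * γ * t ^ (2 + 1) := by
    intro t ht
    refine norm_le_of_norm_deriv_le ht.1
      (X := fun t : ℝ => circleCoeff c 0 (dZ f) t - c₁ - c₃ * t ^ (1 + 1))
      (fun r hr => ((hasDerivAt_circleCoeff_zero (hp.of_le (by norm_num)) (hlt ht.2 hr)).sub_const
        c₁).sub ((hasDerivAt_ofReal_pow 1 r).const_mul c₃))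
      (fun r _ => hasDerivAt_const_mul_pow _ 2 r) (by simp [c₁]) (fun r hr => ?_)
    have := e₂' r ⟨hr.1, hr.2.trans ht.2⟩
    have h2 : 2 * circleCoeff c 1 k r - c₃ * (((1 : ℕ) + 1) * (r : ℂ) ^ 1) =
        2 * (circleCoeff c 1 k r - c₃ * r) := by
      push_cast; ring
    change ‖2 * circleCoeff c 1 k r - c₃ * (((1 : ℕ) + 1) * (r : ℂ) ^ 1)‖ ≤ _
    rw [h2, norm_mul, Complex.norm_ofNat]
    push_cast
    linarith
  have e₄ : ∀ t ∈ Icc 0 s, ‖(t : ℂ) ^ (0 + 1) * circleCoeff c ((0 : ℕ) + 1) f t -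
      (c₁ * t ^ (1 + 1) + c₃ / 2 * t ^ (3 + 1))‖ ≤ 32 / 45 * Real.pi * γ * t ^ (4 + 1) := by
    intro t ht
    refine norm_le_of_norm_deriv_le ht.1
      (X := fun t : ℝ => (t : ℂ) ^ (0 + 1) * circleCoeff c ((0 : ℕ) + 1) f t -
      (c₁ * t ^ (1 + 1) + c₃ / 2 * t ^ (3 + 1)))
      (fun r hr => (hasDerivAt_pow_mul_circleCoeff (hf.of_le (by norm_num)) 0 (hlt ht.2 hr)).sub
        (((hasDerivAt_ofReal_pow 1 r).const_mul c₁).add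
        ((hasDerivAt_ofReal_pow 3 r).const_mul (c₃ / 2))))
      (fun r _ => hasDerivAt_const_mul_pow _ 4 r) (by simp) (fun r hr => ?_)
    have := e₃ r ⟨hr.1, hr.2.trans ht.2⟩
    have h2 : 2 * (r : ℂ) ^ (0 + 1) * circleCoeff c (0 : ℕ) (dZ f) r -
        (c₁ * (((1 : ℕ) + 1) * (r : ℂ) ^ 1) + c₃ / 2 * (((3 : ℕ) + 1) * (r : ℂ) ^ 3)) =
        (2 * r : ℝ) * (circleCoeff c 0 (dZ f) r - c₁ - c₃ * r ^ (1 + 1)) := by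
      push_cast; ring
    rw [h2, norm_mul, norm_real, Real.norm_of_nonneg (by linarith [hr.1])]
    have h3 := mul_le_mul_of_nonneg_left this (show 0 ≤ 2 * r by linarith [hr.1])
    refine h3.trans (le_of_eq ?_)
    push_cast; ring
  -- Constants have no first Fourier coefficient, so only the oscillation of `f` about `f c` counts.
  have hA' : ∀ t ∈ Icc 0 s, ‖circleCoeff c 1 f t‖ ≤ 2 * Real.pi * A := by
    intro t ht
    have h1 := circleCoeff_sub (v := fun _ => f c) 1 hf.continuousOn continuousOn_const
      (hlt le_rfl ht)
    rw [circleCoeff_const c one_ne_zero, sub_zero] at h1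
    rw [← h1]
    exact norm_circleCoeff_le fun θ => hA _ (circleMap_mem_ball_of_abs_lt (hlt le_rfl ht) θ)
  have m₁ : s ∈ Icc 0 s := ⟨hs.le, le_rfl⟩
  have m₂ : s / 2 ∈ Icc 0 s := ⟨by linarith, by linarith⟩
  have a₁ := hA' s m₁
  have a₂ := hA' _ m₂
  have b₁ := e₄ s m₁
  have b₂ := e₄ _ m₂
  simp only [Nat.cast_zero, zero_add] at b₁ b₂
  set x := circleCoeff c 1 f s
  set y := circleCoeff c 1 f (s / 2 : ℝ)
  -- The expansions at radii `s` and `s/2`, with weights `-1` and `16`, cancel the unknown `c₃ t⁴`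
  -- term and leave `(16/4 - 1) s² c₁ = 3 s² c₁`.
  have hfin : 3 * (s : ℂ) ^ 2 * c₁ = 16 * (((s / 2 : ℝ) : ℂ) * y) - s * x
      - 16 * (((s / 2 : ℝ) : ℂ) ^ 1 * y - (c₁ * ((s / 2 : ℝ) : ℂ) ^ (1 + 1) +
        c₃ / 2 * ((s / 2 : ℝ) : ℂ) ^ (3 + 1))) +
      ((s : ℂ) ^ 1 * x - (c₁ * s ^ (1 + 1) + c₃ / 2 * s ^ (3 + 1))) := by
    push_cast; ring
  have hfin' : 3 * s ^ 2 * ‖c₁‖ ≤ 16 * (s / 2 * (2 * Real.pi * A)) + s * (2 * Real.pi * A) +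
      16 * (32 / 45 * Real.pi * γ * (s / 2) ^ (4 + 1)) + 32 / 45 * Real.pi * γ * s ^ (4 + 1) := by
    have h := congrArg norm hfin
    rw [norm_mul, norm_mul, norm_pow, Complex.norm_ofNat, norm_real, Real.norm_of_nonneg hs.le] at h
    rw [h]
    refine (norm_add_le _ _).trans (add_le_add ((norm_sub_le _ _).trans (add_le_add
      ((norm_sub_le _ _).trans (add_le_add ?_ ?_)) ?_)) b₁)
    · rw [norm_mul, norm_mul, Complex.norm_ofNat, norm_real, Real.norm_of_nonneg (by linarith)]
      gcongr
    · rw [norm_mul, norm_real, Real.norm_of_nonneg hs.le]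
      gcongr
    · rw [norm_mul, Complex.norm_ofNat]
      gcongr
  have hc : ‖c₁‖ = 2 * Real.pi * ‖dZ f c‖ := by
    rw [hc₁, circleCoeff_zero_radius, norm_mul, norm_mul, Complex.norm_ofNat, norm_real,
      Real.norm_of_nonneg hπ.le]
  rw [hc] at hfin'
  have h6 : (2 * Real.pi * s) * (3 * s * ‖dZ f c‖) ≤
      (2 * Real.pi * s) * (9 * A + 3 * γ * s ^ 4) := by
    have : 0 ≤ Real.pi * γ * s ^ 5 := by positivity
    nlinarith [hfin', this]
  have h7 := le_of_mul_le_mul_left h6 (by positivity)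
  have h8 : 3 * A / s + γ * s ^ 3 = (9 * A + 3 * γ * s ^ 4) / (3 * s) := by
    field_simp
    ring
  rw [h8, le_div_iff₀ (by positivity)]
  linarith

/-! ### Mean value formula with remainder -/

theorem hasDerivAt_inv_one_sub_pow {ρ t : ℝ} (h : 1 - ρ * t ≠ 0) (n : ℕ) :
    HasDerivAt (fun t : ℝ => (1 - ρ * t)⁻¹ ^ (n + 1))
      ((n + 1) * ρ * (1 - ρ * t)⁻¹ ^ (n + 2)) t := by
  have h1 : HasDerivAt (fun t : ℝ => 1 - ρ * t) (-ρ) t := by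
    simpa using ((hasDerivAt_id t).const_mul ρ).const_sub 1
  have h2 := (h1.fun_inv h).fun_pow (n + 1)
  refine h2.congr_deriv ?_
  push_cast
  rw [neg_neg, div_eq_mul_inv, ← inv_pow]
  ring

/-- Mean value formula for the bilaplacian at the centre of the unit disk, with remainder. -/
theorem norm_circleCoeff_sub_le {F : ℂ → ℂ} {ρ C : ℝ} (hρ : 0 < ρ) (hρ1 : ρ < 1) (hC : 0 ≤ C)
    (hF : ContDiffOn ℝ 4 F (ball 0 1))
    (hN : ∀ u ∈ ball (0 : ℂ) 1, ‖dZ (dZ (dZBar (dZBar F))) u‖ ≤ C * (1 - ρ * ‖u‖)⁻¹ ^ 6)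
    {r : ℝ} (hr : r ∈ Ico (0 : ℝ) 1) :
    ‖circleCoeff 0 0 F r - r * circleCoeff 0 1 (dZBar F) r - 2 * Real.pi * F 0‖ ≤
      4 * Real.pi * C / (15 * ρ ^ 3) * (1 - ρ * r)⁻¹ ^ 3 := by
  have hπ := Real.pi_pos
  have h1 : ContDiffOn ℝ 3 (dZBar F) (ball 0 1) := contDiffOn_dZBar isOpen_ball hF (by norm_num)
  have h2 : ContDiffOn ℝ 2 (dZBar (dZBar F)) (ball 0 1) :=
    contDiffOn_dZBar isOpen_ball h1 (by norm_num)
  have h3 : ContDiffOn ℝ 1 (dZ (dZBar (dZBar F))) (ball 0 1) :=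
    contDiffOn_dZ isOpen_ball h2 (by norm_num)
  set F₁ := dZBar F
  set F₂ := dZBar F₁
  set F₃ := dZ F₂
  have habs : ∀ {s t : ℝ}, t ∈ Ico (0 : ℝ) 1 → s ∈ Icc 0 t → |s| < 1 := fun ht hs => by
    rw [abs_of_nonneg hs.1]; exact hs.2.trans_lt ht.2
  have hpos : ∀ {t : ℝ}, t ∈ Ico (0 : ℝ) 1 → 0 < 1 - ρ * t := fun {t} ht => by
    nlinarith [ht.1, ht.2]
  have hmem : ∀ {s t : ℝ}, t ∈ Ico (0 : ℝ) 1 → s ∈ Icc 0 t → s ∈ Ico (0 : ℝ) 1 :=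
    fun ht hs => ⟨hs.1, hs.2.trans_lt ht.2⟩
  have e₄ : ∀ t ∈ Ico (0 : ℝ) 1, ‖circleCoeff 0 0 (dZ F₃) t‖ ≤
      2 * Real.pi * (C * (1 - ρ * t)⁻¹ ^ 6) := by
    intro t ht
    have ht' : |t| < 1 := by rw [abs_of_nonneg ht.1]; exact ht.2
    refine norm_circleCoeff_le fun θ => ?_
    have := hN _ (circleMap_mem_ball_of_abs_lt (c := 0) ht' θ)
    rwa [norm_circleMap_zero, abs_of_nonneg ht.1] at this
  -- Each of the three integrations in the radius lowers the power of `(1-ρt)⁻¹` by one, from 6 to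
  -- 3. `K₃`, `K₂`, `K₁` are chosen so that differentiating the power in the majorant already
  -- reproduces the required bound; in the first two, differentiating the factor `t` or `t²` only
  -- adds a nonnegative term.
  set K₃ := 4 * Real.pi * C / (5 * ρ) with hK₃
  have hK₃0 : 0 ≤ K₃ := by positivity
  have e₃ : ∀ t ∈ Ico (0 : ℝ) 1, ‖circleCoeff 0 1 F₃ t‖ ≤ K₃ * (1 - ρ * t)⁻¹ ^ 5 := by
    intro t ht
    rcases ht.1.eq_or_lt with rfl | h0
    · rw [circleCoeff_zero_radius_of_ne _ _ one_ne_zero, norm_zero]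
      simpa using hK₃0
    have key : ‖(t : ℂ) ^ (0 + 1) * circleCoeff 0 ((0 : ℕ) + 1) F₃ t‖ ≤
        K₃ * (t ^ (0 + 1) * (1 - ρ * t)⁻¹ ^ 5) := by
      refine norm_le_of_norm_deriv_le ht.1
        (X := fun t : ℝ => (t : ℂ) ^ (0 + 1) * circleCoeff 0 ((0 : ℕ) + 1) F₃ t)
        (fun s hs => hasDerivAt_pow_mul_circleCoeff h3 0 (habs ht hs))
        (B := fun t => K₃ * (t ^ (0 + 1) * (1 - ρ * t)⁻¹ ^ 5))
        (fun s hs => ((((hasDerivAt_id s).fun_pow 1).fun_mul (hasDerivAt_inv_one_sub_pow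
          (hpos (hmem ht hs)).ne' 4)).const_mul K₃)) (by simp) (fun s hs => ?_)
      have hs1 := hmem ht hs
      have hq := inv_pos.2 (hpos hs1)
      have := e₄ s hs1
      rw [norm_mul, norm_mul, Complex.norm_ofNat, norm_pow, norm_real,
        Real.norm_of_nonneg hs1.1]
      have h5 : K₃ * (5 * ρ) = 4 * Real.pi * C := by rw [hK₃]; field_simp
      have h6 := mul_le_mul_of_nonneg_left this (show 0 ≤ 2 * s by linarith [hs1.1])
      have h7 : 0 ≤ K₃ * (1 - ρ * s)⁻¹ ^ 5 := by positivity
      have h8 : 2 * s * (2 * Real.pi * (C * (1 - ρ * s)⁻¹ ^ 6)) =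
        K₃ * (s * (5 * ρ * (1 - ρ * s)⁻¹ ^ 6)) := by
        linear_combination (-s * (1 - ρ * s)⁻¹ ^ 6) * h5
      simp only [id, zero_add, pow_one, Nat.sub_self, pow_zero, Nat.cast_one, Nat.cast_ofNat,
        Nat.cast_zero]
      norm_num
      calc _ ≤ _ := h6
        _ = _ := h8
        _ ≤ _ := by
          norm_num at h7 ⊢
          nlinarith
    rw [norm_mul, norm_pow, norm_real, Real.norm_of_nonneg ht.1] at key
    simp only [zero_add, pow_one, Nat.cast_zero] at key
    refine le_of_mul_le_mul_left (key.trans (le_of_eq ?_)) h0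
    ring
  set K₂ := K₃ / (2 * ρ) with hK₂
  have hK₂0 : 0 ≤ K₂ := by positivity
  have e₂ : ∀ t ∈ Ico (0 : ℝ) 1, ‖circleCoeff 0 2 F₂ t‖ ≤ K₂ * (1 - ρ * t)⁻¹ ^ 4 := by
    intro t ht
    rcases ht.1.eq_or_lt with rfl | h0
    · rw [circleCoeff_zero_radius_of_ne _ _ two_ne_zero, norm_zero]
      simpa using hK₂0
    have key : ‖(t : ℂ) ^ (1 + 1) * circleCoeff 0 ((1 : ℕ) + 1) F₂ t‖ ≤
        K₂ * (t ^ 2 * (1 - ρ * t)⁻¹ ^ 4) := by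
      refine norm_le_of_norm_deriv_le ht.1
        (X := fun t : ℝ => (t : ℂ) ^ (1 + 1) * circleCoeff 0 ((1 : ℕ) + 1) F₂ t)
        (fun s hs => hasDerivAt_pow_mul_circleCoeff (h2.of_le (by norm_num)) 1 (habs ht hs))
        (B := fun t => K₂ * (t ^ 2 * (1 - ρ * t)⁻¹ ^ 4))
        (fun s hs => ((((hasDerivAt_id s).fun_pow 2).fun_mul (hasDerivAt_inv_one_sub_pow
          (hpos (hmem ht hs)).ne' 3)).const_mul K₂)) (by simp) (fun s hs => ?_)
      have hs1 := hmem ht hs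
      have hs0 : 0 ≤ s := hs1.1
      have hq := inv_pos.2 (hpos hs1)
      have := e₃ s hs1
      rw [norm_mul, norm_mul, Complex.norm_ofNat, norm_pow, norm_real,
        Real.norm_of_nonneg hs1.1]
      have h5 : K₂ * (2 * ρ) = K₃ := by rw [hK₂]; field_simp
      have h6 := mul_le_mul_of_nonneg_left this (show 0 ≤ 2 * s ^ 2 by positivity)
      have h7 : 0 ≤ K₂ * (2 * s * (1 - ρ * s)⁻¹ ^ 4) := by positivity
      have h8 : 2 * s ^ 2 * (K₃ * (1 - ρ * s)⁻¹ ^ 5) =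
        K₂ * (s ^ 2 * (4 * ρ * (1 - ρ * s)⁻¹ ^ 5)) := by
        linear_combination (-2 * s ^ 2 * (1 - ρ * s)⁻¹ ^ 5) * h5
      norm_num
      norm_num at h6 h7 h8
      calc _ ≤ _ := h6
        _ = _ := h8
        _ ≤ _ := by nlinarith
    rw [norm_mul, norm_pow, norm_real, Real.norm_of_nonneg ht.1] at key
    norm_num at key
    refine le_of_mul_le_mul_left (key.trans (le_of_eq ?_)) (show 0 < t ^ 2 by positivity)
    norm_num
    ring
  set K₁ := 2 * K₂ / (3 * ρ) with hK₁
  have e₁ : ‖circleCoeff 0 0 F r - r * circleCoeff 0 1 F₁ r - 2 * Real.pi * F 0‖ ≤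
      K₁ * (1 - ρ * r)⁻¹ ^ 3 := by
    -- The zeroth coefficient of `∂F₁` cancels here: `(F_0)' = 2 (F₁)_1`, and the angular identity
    -- expresses `(F₁)_1` through `(∂F₁)_0` and `(F₂)_2`.
    have hder : ∀ s ∈ Icc 0 r, HasDerivAt
        (fun t : ℝ => circleCoeff 0 0 F t - t * circleCoeff 0 1 F₁ t - 2 * Real.pi * F 0)
        (-(2 * s * circleCoeff 0 2 F₂ s)) s := by
      intro s hs
      have d1 := hasDerivAt_circleCoeff_zero (hF.of_le (by norm_num)) (habs hr hs)
      have d2 := hasDerivAt_circleCoeff (h1.of_le (by norm_num)) 1 (habs hr hs)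
      have d3 := mul_circleCoeff (h1.of_le (by norm_num)) 1 (habs hr hs)
      have d0 : HasDerivAt (fun t : ℝ => (t : ℂ)) 1 s := ofRealCLM.hasDerivAt (x := s)
      refine ((d1.sub (d0.fun_mul d2)).sub_const _).congr_deriv ?_
      change 2 * circleCoeff 0 1 F₁ s - (1 * circleCoeff 0 1 F₁ s + s *
        (circleCoeff 0 (1 - 1) (dZ F₁) s + circleCoeff 0 2 F₂ s)) = _
      change ((1 : ℤ) : ℂ) * circleCoeff 0 1 F₁ s = s *
        (circleCoeff 0 (1 - 1) (dZ F₁) s - circleCoeff 0 2 F₂ s) at d3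
      rw [Int.cast_one] at d3
      linear_combination d3
    refine norm_le_of_norm_deriv_le hr.1 hder
      (B := fun t => K₁ * (1 - ρ * t)⁻¹ ^ 3)
      (fun s hs => (hasDerivAt_inv_one_sub_pow (hpos (hmem hr hs)).ne' 2).const_mul K₁)
      ?_ (fun s hs => ?_)
    · rw [circleCoeff_zero_radius]
      simp only [ofReal_zero, zero_mul, sub_zero, sub_self, norm_zero, mul_zero, inv_one, one_pow,
        mul_one]
      positivity
    · have hs1 := hmem hr hs
      have hq := inv_pos.2 (hpos hs1)
      have := e₂ s hs1
      rw [norm_neg, norm_mul, norm_mul, Complex.norm_ofNat, norm_real, Real.norm_of_nonneg hs1.1]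
      have h5 : K₁ * (3 * ρ) = 2 * K₂ := by rw [hK₁]; field_simp
      have h7 : 0 ≤ K₂ * (1 - ρ * s)⁻¹ ^ 4 := by positivity
      have h6 : 2 * s * ‖circleCoeff 0 2 F₂ s‖ ≤ 2 * 1 * (K₂ * (1 - ρ * s)⁻¹ ^ 4) := by
        have := hs1.2.le
        have := hs1.1
        gcongr
      have h8 : 2 * 1 * (K₂ * (1 - ρ * s)⁻¹ ^ 4) = K₁ * (3 * ρ * (1 - ρ * s)⁻¹ ^ 4) := by
        linear_combination (-(1 - ρ * s)⁻¹ ^ 4) * h5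
      norm_num
      norm_num at h6 h8
      exact h6.trans (le_of_eq h8)
  refine e₁.trans (le_of_eq ?_)
  rw [hK₁, hK₂, hK₃]
  field_simp
  ring

theorem HasWirtinger.dZ_eq_of_eqOn {f g : ℂ → ℂ} {p q u : ℂ} {U : Set ℂ}
    (h : HasWirtinger g p q u) (hU : IsOpen U) (hu : u ∈ U) (he : ∀ v ∈ U, f v = g v) :
    dZ f u = p :=
  (dZ_congr (eventually_of_mem (hU.mem_nhds hu) he)).trans h.dZ_eq

/-! ### Disk automorphisms and conformal covariance of the bilaplacian -/

/-- The disk automorphism `u ↦ η (u - ρ) / (1 - ρ u)`. -/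
noncomputable def mobius (η : ℂ) (ρ : ℝ) (u : ℂ) : ℂ := η * (u - ρ) * (1 - ρ * u)⁻¹

theorem one_sub_le_norm {ρ : ℝ} (hρ : 0 ≤ ρ) (u : ℂ) : 1 - ρ * ‖u‖ ≤ ‖1 - ρ * u‖ := by
  have := norm_sub_norm_le (1 : ℂ) (ρ * u)
  rwa [norm_one, norm_mul, norm_real, Real.norm_of_nonneg hρ] at this

theorem one_sub_mul_ne_zero {ρ : ℝ} (hρ : 0 ≤ ρ) (hρ1 : ρ < 1) {u : ℂ} (hu : ‖u‖ ≤ 1) :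
    1 - ρ * u ≠ 0 := by
  have := one_sub_le_norm hρ u
  rw [← norm_pos_iff]
  nlinarith [norm_nonneg u]

theorem conj_one_sub_mul (ρ : ℝ) (u : ℂ) :
    (starRingEnd ℂ) (1 - ρ * u) = 1 - ρ * (starRingEnd ℂ) u := by
  simp

theorem one_sub_mul_conj_ne_zero {ρ : ℝ} {u : ℂ} (h : 1 - ρ * u ≠ 0) :
    1 - ρ * (starRingEnd ℂ) u ≠ 0 := by
  rw [← conj_one_sub_mul]
  exact (map_ne_zero _).2 h

theorem hasDerivAt_cinv_one_sub_pow {ρ u : ℂ} (h : 1 - ρ * u ≠ 0) (n : ℕ) :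
    HasDerivAt (fun u : ℂ => (1 - ρ * u)⁻¹ ^ (n + 1))
      ((n + 1) * ρ * (1 - ρ * u)⁻¹ ^ (n + 2)) u := by
  have h1 : HasDerivAt (fun u : ℂ => 1 - ρ * u) (-ρ) u := by
    simpa using ((hasDerivAt_id u).const_mul ρ).const_sub 1
  have h2 := (h1.fun_inv h).fun_pow (n + 1)
  refine h2.congr_deriv ?_
  push_cast
  rw [neg_neg, div_eq_mul_inv, ← inv_pow]
  ring

theorem hasDerivAt_mobius (η : ℂ) {ρ : ℝ} {u : ℂ} (h : 1 - ρ * u ≠ 0) :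
    HasDerivAt (mobius η ρ) (η * (1 - ρ ^ 2) * (1 - ρ * u)⁻¹ ^ 2) u := by
  have h1 := hasDerivAt_cinv_one_sub_pow h 0
  simp only [zero_add, pow_one] at h1
  have h2 : HasDerivAt (fun u : ℂ => η * (u - ρ)) η u := by
    simpa using ((hasDerivAt_id u).sub_const (ρ : ℂ)).const_mul η
  refine (h2.mul h1).congr_deriv ?_
  have h3 : (1 - ρ * u) * (1 - ρ * u)⁻¹ = 1 := mul_inv_cancel₀ h
  simp only [Nat.cast_zero]
  linear_combination (-η * (1 - ρ * u)⁻¹) * h3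

/-- Its sign shows that `mobius η ρ` preserves both the open disk and the unit circle when `|η| =
1`. -/
theorem normSq_one_sub_sub (ρ : ℝ) (u : ℂ) :
    ‖1 - ρ * u‖ ^ 2 - ‖u - ρ‖ ^ 2 = (1 - ρ ^ 2) * (1 - ‖u‖ ^ 2) := by
  simp only [← normSq_eq_norm_sq, normSq_apply]
  simp
  ring

theorem mobius_mem_ball {η : ℂ} {ρ : ℝ} (hη : ‖η‖ = 1) (hρ : 0 ≤ ρ) (hρ1 : ρ < 1) {u : ℂ}
    (hu : u ∈ ball (0 : ℂ) 1) : mobius η ρ u ∈ ball (0 : ℂ) 1 := by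
  rw [mem_ball_zero_iff] at *
  have h0 := norm_pos_iff.2 (one_sub_mul_ne_zero hρ hρ1 hu.le)
  have h := normSq_one_sub_sub ρ u
  have h1 : 0 < (1 - ρ ^ 2) * (1 - ‖u‖ ^ 2) :=
    mul_pos (by nlinarith) (by nlinarith [norm_nonneg u])
  rw [mobius, norm_mul, norm_mul, hη, one_mul, norm_inv, ← div_eq_mul_inv, div_lt_one h0]
  exact lt_of_pow_lt_pow_left₀ 2 h0.le (by linarith)

theorem mobius_mem_sphere {η : ℂ} {ρ : ℝ} (hη : ‖η‖ = 1) (hρ : 0 ≤ ρ) (hρ1 : ρ < 1) {u : ℂ}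
    (hu : u ∈ sphere (0 : ℂ) 1) : mobius η ρ u ∈ sphere (0 : ℂ) 1 := by
  rw [mem_sphere_zero_iff_norm] at *
  have h0 := norm_pos_iff.2 (one_sub_mul_ne_zero hρ hρ1 hu.le)
  have h := normSq_one_sub_sub ρ u
  rw [mobius, norm_mul, norm_mul, hη, one_mul, norm_inv, ← div_eq_mul_inv, div_eq_one_iff_eq h0.ne']
  refine (pow_left_inj₀ (norm_nonneg _) h0.le two_ne_zero).1 ?_
  rw [hu] at h
  linarith

theorem hasWirtinger_const (a z : ℂ) : HasWirtinger (fun _ => a) 0 0 z :=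
  hasWirtinger_of_hasDerivAt (hasDerivAt_const z a)

theorem hasWirtinger_one_sub (ρ : ℝ) (u : ℂ) : HasWirtinger (fun u => 1 - ρ * u) (-ρ) 0 u := by
  refine hasWirtinger_of_hasDerivAt ?_
  simpa using ((hasDerivAt_id u).const_mul (ρ : ℂ)).const_sub 1

theorem hasWirtinger_one_sub_conj (ρ : ℝ) (u : ℂ) :
    HasWirtinger (fun u => 1 - ρ * (starRingEnd ℂ) u) 0 (-ρ) u := by
  have h : HasDerivAt (fun v : ℂ => 1 - ρ * v) (-ρ : ℂ) ((starRingEnd ℂ) u) := by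
    simpa using ((hasDerivAt_id ((starRingEnd ℂ) u)).const_mul (ρ : ℂ)).const_sub 1
  exact ((hasWirtinger_conj u).holomorphic_comp h).congr (by ring) (by ring)

theorem hasWirtinger_inv_one_sub_conj {ρ : ℝ} {u : ℂ} (h : 1 - ρ * u ≠ 0) (n : ℕ) :
    HasWirtinger (fun u => (1 - ρ * (starRingEnd ℂ) u)⁻¹ ^ (n + 1)) 0
      ((n + 1) * ρ * (1 - ρ * (starRingEnd ℂ) u)⁻¹ ^ (n + 2)) u :=
  ((hasWirtinger_conj u).holomorphic_comp (hasDerivAt_cinv_one_sub_pow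
    (one_sub_mul_conj_ne_zero h) n)).congr (by ring) (by ring)

/-- The transform `f ↦ (f ∘ σ) / |σ'|` (up to normalisation) under which the bilaplacian is
covariant, for `σ = mobius η ρ`. -/
noncomputable def bolTransform (η : ℂ) (ρ : ℝ) (f : ℂ → ℂ) (u : ℂ) : ℂ :=
  f (mobius η ρ u) * ((1 - ρ * u) * (1 - ρ * (starRingEnd ℂ) u) * (1 - (ρ : ℂ) ^ 2)⁻¹)

section Bol

variable {η : ℂ} {ρ : ℝ} {f : ℂ → ℂ}

theorem HasWirtinger.comp_mobius {p q u : ℂ} (h : 1 - ρ * u ≠ 0)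
    (hf : HasWirtinger f p q (mobius η ρ u)) :
    HasWirtinger (fun u => f (mobius η ρ u)) (p * (η * (1 - ρ ^ 2) * (1 - ρ * u)⁻¹ ^ 2))
      (q * ((starRingEnd ℂ) η * (1 - ρ ^ 2) * (1 - ρ * (starRingEnd ℂ) u)⁻¹ ^ 2)) u :=
  (hf.comp_holomorphic (hasDerivAt_mobius η h)).congr rfl (by simp)

theorem contDiffOn_bolTransform {n : WithTop ℕ∞} (hη : ‖η‖ = 1) (hρ : 0 ≤ ρ) (hρ1 : ρ < 1)
    (hf : ContDiffOn ℝ n f (ball 0 1)) : ContDiffOn ℝ n (bolTransform η ρ f) (ball 0 1) := by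
  have hne : ∀ u ∈ ball (0 : ℂ) 1, 1 - ρ * u ≠ 0 := fun u hu =>
    one_sub_mul_ne_zero hρ hρ1 (mem_ball_zero_iff.1 hu).le
  have h1 : ContDiff ℝ n fun u : ℂ => 1 - ρ * u := by fun_prop
  have h2 : ContDiff ℝ n fun u : ℂ => 1 - ρ * (starRingEnd ℂ) u :=
    contDiff_const.sub (contDiff_const.mul conjCLE.contDiff)
  have h3 : ContDiffOn ℝ n (mobius η ρ) (ball 0 1) :=
    (by fun_prop : ContDiff ℝ n fun u : ℂ => η * (u - ρ)).contDiffOn.mul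
      (h1.contDiffOn.inv hne)
  exact (hf.comp h3 fun u hu => mobius_mem_ball hη hρ hρ1 hu).mul
    ((h1.contDiffOn.mul h2.contDiffOn).mul contDiffOn_const)

theorem one_sub_sq_ne_zero (hρ : 0 ≤ ρ) (hρ1 : ρ < 1) : 1 - (ρ : ℂ) ^ 2 ≠ 0 := by
  have : (1 - ρ ^ 2 : ℝ) ≠ 0 := by nlinarith
  exact_mod_cast this

theorem dZBar_bolTransform (hη : ‖η‖ = 1) (hρ : 0 ≤ ρ) (hρ1 : ρ < 1)
    (hf : ContDiffOn ℝ 4 f (ball 0 1)) {u : ℂ} (hu : u ∈ ball (0 : ℂ) 1) :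
    dZBar (bolTransform η ρ f) u = (1 - ρ * u) *
      ((starRingEnd ℂ) η * dZBar f (mobius η ρ u) * (1 - ρ * (starRingEnd ℂ) u)⁻¹ -
        ρ * (1 - (ρ : ℂ) ^ 2)⁻¹ * f (mobius η ρ u)) := by
  have h := one_sub_mul_ne_zero hρ hρ1 (mem_ball_zero_iff.1 hu).le
  have hd : HasWirtinger f _ _ (mobius η ρ u) := hasWirtinger_of_differentiableAt
    ((hf.differentiableOn (by norm_num)).differentiableAt
      (isOpen_ball.mem_nhds (mobius_mem_ball hη hρ hρ1 hu)))
  have key := (hd.comp_mobius h).mul (((hasWirtinger_one_sub ρ u).mul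
    (hasWirtinger_one_sub_conj ρ u)).mul (hasWirtinger_const (1 - (ρ : ℂ) ^ 2)⁻¹ u))
  refine (key.dZBar_eq).trans ?_
  have e1 : (1 - ρ * (starRingEnd ℂ) u) * (1 - ρ * (starRingEnd ℂ) u)⁻¹ = 1 :=
    mul_inv_cancel₀ (one_sub_mul_conj_ne_zero h)
  have e2 : (1 - (ρ : ℂ) ^ 2) * (1 - (ρ : ℂ) ^ 2)⁻¹ = 1 :=
    mul_inv_cancel₀ (one_sub_sq_ne_zero hρ hρ1)
  generalize (1 - ρ * (starRingEnd ℂ) u)⁻¹ = V at *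
  generalize (1 - (ρ : ℂ) ^ 2)⁻¹ = E at *
  linear_combination (dZBar f (mobius η ρ u) * (starRingEnd ℂ) η * (1 - ρ * u) * V) *
    ((1 - (ρ : ℂ) ^ 2) * E * e1 + e2)

/-- Bol's lemma in the variable `z̄`: with the weight `1/|σ'|`, the terms in `f` and `∂̄f` cancel
and only `∂̄²f` survives. -/
theorem dZBar_dZBar_bolTransform (hη : ‖η‖ = 1) (hρ : 0 ≤ ρ) (hρ1 : ρ < 1)
    (hf : ContDiffOn ℝ 4 f (ball 0 1)) {u : ℂ} (hu : u ∈ ball (0 : ℂ) 1) :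
    dZBar (dZBar (bolTransform η ρ f)) u = (1 - ρ * u) *
      ((starRingEnd ℂ) η ^ 2 * (1 - (ρ : ℂ) ^ 2) * ((1 - ρ * (starRingEnd ℂ) u)⁻¹ ^ 3 *
        dZBar (dZBar f) (mobius η ρ u))) := by
  have h := one_sub_mul_ne_zero hρ hρ1 (mem_ball_zero_iff.1 hu).le
  have hm := isOpen_ball.mem_nhds (mobius_mem_ball hη hρ hρ1 hu)
  have hf1 : ContDiffOn ℝ 3 (dZBar f) (ball 0 1) := contDiffOn_dZBar isOpen_ball hf (by norm_num)
  have hd : HasWirtinger f _ _ (mobius η ρ u) := hasWirtinger_of_differentiableAt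
    ((hf.differentiableOn (by norm_num)).differentiableAt hm)
  have hd1 : HasWirtinger (dZBar f) _ _ (mobius η ρ u) := hasWirtinger_of_differentiableAt
    ((hf1.differentiableOn (by norm_num)).differentiableAt hm)
  have hev : dZBar (bolTransform η ρ f) =ᶠ[𝓝 u] fun u => (1 - ρ * u) *
      ((starRingEnd ℂ) η * dZBar f (mobius η ρ u) * (1 - ρ * (starRingEnd ℂ) u)⁻¹ ^ (0 + 1) +
        (-(ρ * (1 - (ρ : ℂ) ^ 2)⁻¹)) * f (mobius η ρ u)) := by
    filter_upwards [isOpen_ball.mem_nhds hu] with v hv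
    rw [dZBar_bolTransform hη hρ hρ1 hf hv]
    ring
  have key := (hasWirtinger_one_sub ρ u).mul ((((hasWirtinger_const ((starRingEnd ℂ) η) u).mul
    (hd1.comp_mobius h)).mul (hasWirtinger_inv_one_sub_conj h 0)).add
      ((hasWirtinger_const (-(ρ * (1 - (ρ : ℂ) ^ 2)⁻¹)) u).mul (hd.comp_mobius h)))
  rw [dZBar_congr hev]
  refine (key.dZBar_eq).trans ?_
  have e2 : (1 - (ρ : ℂ) ^ 2) * (1 - (ρ : ℂ) ^ 2)⁻¹ = 1 :=
    mul_inv_cancel₀ (one_sub_sq_ne_zero hρ hρ1)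
  generalize (1 - ρ * (starRingEnd ℂ) u)⁻¹ = V at *
  generalize (1 - (ρ : ℂ) ^ 2)⁻¹ = E at *
  push_cast
  linear_combination (-(1 - ρ * u) * (starRingEnd ℂ) η * dZBar f (mobius η ρ u) * ρ * V ^ 2) * e2

theorem dZ_dZBar_dZBar_bolTransform (hη : ‖η‖ = 1) (hρ : 0 ≤ ρ) (hρ1 : ρ < 1)
    (hf : ContDiffOn ℝ 4 f (ball 0 1)) {u : ℂ} (hu : u ∈ ball (0 : ℂ) 1) :
    dZ (dZBar (dZBar (bolTransform η ρ f))) u = (starRingEnd ℂ) η ^ 2 * (1 - (ρ : ℂ) ^ 2) *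
      ((1 - ρ * (starRingEnd ℂ) u)⁻¹ ^ 3 * (-ρ * dZBar (dZBar f) (mobius η ρ u) +
        η * (1 - (ρ : ℂ) ^ 2) * ((1 - ρ * u)⁻¹ * dZ (dZBar (dZBar f)) (mobius η ρ u)))) := by
  have h := one_sub_mul_ne_zero hρ hρ1 (mem_ball_zero_iff.1 hu).le
  have hm := isOpen_ball.mem_nhds (mobius_mem_ball hη hρ hρ1 hu)
  have hf1 : ContDiffOn ℝ 3 (dZBar f) (ball 0 1) := contDiffOn_dZBar isOpen_ball hf (by norm_num)
  have hf2 : ContDiffOn ℝ 2 (dZBar (dZBar f)) (ball 0 1) :=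
    contDiffOn_dZBar isOpen_ball hf1 (by norm_num)
  have hd : HasWirtinger (dZBar (dZBar f)) _ _ (mobius η ρ u) := hasWirtinger_of_differentiableAt
    ((hf2.differentiableOn (by norm_num)).differentiableAt hm)
  have key := (hasWirtinger_one_sub ρ u).mul ((hasWirtinger_const ((starRingEnd ℂ) η ^ 2 *
    (1 - (ρ : ℂ) ^ 2)) u).mul ((hasWirtinger_inv_one_sub_conj h 2).mul (hd.comp_mobius h)))
  refine (key.dZ_eq_of_eqOn isOpen_ball hu fun v hv =>
    dZBar_dZBar_bolTransform hη hρ hρ1 hf hv).trans ?_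
  have e1 : (1 - ρ * u) * (1 - ρ * u)⁻¹ = 1 := mul_inv_cancel₀ h
  generalize (1 - ρ * (starRingEnd ℂ) u)⁻¹ = V at *
  generalize (1 - ρ * u)⁻¹ = U at *
  linear_combination ((starRingEnd ℂ) η ^ 2 * (1 - (ρ : ℂ) ^ 2) * V ^ 3 * η * (1 - (ρ : ℂ) ^ 2) *
    U * dZ (dZBar (dZBar f)) (mobius η ρ u)) * e1

/-- The same cancellation in `z`: the powers of `1 - ρū` are antiholomorphic and pass through `∂`,
and the two terms in `∂∂̄²f` cancel. The resulting factor has modulus `|σ'|³` when `|η| = 1`. -/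
theorem bilaplacian_bolTransform (hη : ‖η‖ = 1) (hρ : 0 ≤ ρ) (hρ1 : ρ < 1)
    (hf : ContDiffOn ℝ 4 f (ball 0 1)) {u : ℂ} (hu : u ∈ ball (0 : ℂ) 1) :
    dZ (dZ (dZBar (dZBar (bolTransform η ρ f)))) u =
      (starRingEnd ℂ) η ^ 2 * η ^ 2 * (1 - (ρ : ℂ) ^ 2) ^ 3 *
      ((1 - ρ * (starRingEnd ℂ) u)⁻¹ ^ 3 * (1 - ρ * u)⁻¹ ^ 3 *
        dZ (dZ (dZBar (dZBar f))) (mobius η ρ u)) := by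
  have h := one_sub_mul_ne_zero hρ hρ1 (mem_ball_zero_iff.1 hu).le
  have hm := isOpen_ball.mem_nhds (mobius_mem_ball hη hρ hρ1 hu)
  have hf1 : ContDiffOn ℝ 3 (dZBar f) (ball 0 1) := contDiffOn_dZBar isOpen_ball hf (by norm_num)
  have hf2 : ContDiffOn ℝ 2 (dZBar (dZBar f)) (ball 0 1) :=
    contDiffOn_dZBar isOpen_ball hf1 (by norm_num)
  have hf3 : ContDiffOn ℝ 1 (dZ (dZBar (dZBar f))) (ball 0 1) :=
    contDiffOn_dZ isOpen_ball hf2 (by norm_num)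
  have hd : HasWirtinger (dZBar (dZBar f)) _ _ (mobius η ρ u) := hasWirtinger_of_differentiableAt
    ((hf2.differentiableOn (by norm_num)).differentiableAt hm)
  have hd1 : HasWirtinger (dZ (dZBar (dZBar f))) _ _ (mobius η ρ u) :=
    hasWirtinger_of_differentiableAt ((hf3.differentiableOn (by norm_num)).differentiableAt hm)
  have hU := hasWirtinger_of_hasDerivAt (hasDerivAt_cinv_one_sub_pow h 0)
  simp only [zero_add, pow_one] at hU
  have key := (hasWirtinger_const ((starRingEnd ℂ) η ^ 2 * (1 - (ρ : ℂ) ^ 2)) u).mul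
    ((hasWirtinger_inv_one_sub_conj h 2).mul (((hasWirtinger_const (-ρ : ℂ) u).mul
      (hd.comp_mobius h)).add ((hasWirtinger_const (η * (1 - (ρ : ℂ) ^ 2)) u).mul
        (hU.mul (hd1.comp_mobius h)))))
  refine (key.dZ_eq_of_eqOn isOpen_ball hu fun v hv =>
    dZ_dZBar_dZBar_bolTransform hη hρ hρ1 hf hv).trans ?_
  push_cast
  ring

end Bol

/-! ### Approximate mean value formula at an arbitrary point -/

theorem mobius_zero (η : ℂ) (ρ : ℝ) : mobius η ρ 0 = -(η * ρ) := by simp [mobius]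

theorem continuousOn_mobius (η : ℂ) {ρ : ℝ} (hρ : 0 ≤ ρ) (hρ1 : ρ < 1) :
    ContinuousOn (mobius η ρ) (closedBall 0 1) := fun _ hu =>
  (hasDerivAt_mobius η (one_sub_mul_ne_zero hρ hρ1 (mem_closedBall_zero_iff.1 hu))
    ).continuousAt.continuousWithinAt

theorem norm_one_sub_mul_le {ρ : ℝ} (hρ : 0 ≤ ρ) (hρ1 : ρ < 1) {u : ℂ} (hu : ‖u‖ ≤ 1) :
    ‖1 - ρ * u‖ ≤ 2 := by
  refine (norm_sub_le _ _).trans ?_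
  rw [norm_one, norm_mul, norm_real, Real.norm_of_nonneg hρ]
  nlinarith [norm_nonneg u]

/-- Approximate mean value formula for functions with bounded bilaplacian and bounded `∂f/∂z̄`. -/
theorem norm_integral_sub_le {f : ℂ → ℂ} {η : ℂ} {ρ γ K : ℝ} (hη : ‖η‖ = 1) (hρ : 1 / 2 ≤ ρ)
    (hρ1 : ρ < 1) (hf : ContDiffOn ℝ 4 f (ball 0 1))
    (hγ : ∀ z ∈ ball (0 : ℂ) 1, ‖dZ (dZ (dZBar (dZBar f))) z‖ ≤ γ)
    (hK : ∀ z ∈ ball (0 : ℂ) 1, ‖dZBar f z‖ ≤ K) {r : ℝ} (hr : r ∈ Ico (0 : ℝ) 1) :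
    ‖(∫ θ in -Real.pi..Real.pi, (1 - ρ * circleMap 0 r θ) * f (mobius η ρ (circleMap 0 r θ))) -
      2 * Real.pi * f (-(η * ρ))‖ ≤ (1 - ρ ^ 2) * (2 * Real.pi * K + 20 * Real.pi * γ) := by
  have hπ := Real.pi_pos
  have hρ0 : 0 < ρ := by linarith
  have hball : (0 : ℂ) ∈ ball (0 : ℂ) 1 := mem_ball_self one_pos
  have hγ0 : 0 ≤ γ := (norm_nonneg _).trans (hγ 0 hball)
  have hD : 0 < 1 - ρ ^ 2 := by nlinarith
  have hr' : |r| < 1 := by rw [abs_of_nonneg hr.1]; exact hr.2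
  have hF := contDiffOn_bolTransform hη hρ0.le hρ1 hf
  have hF1 : ContDiffOn ℝ 3 (dZBar (bolTransform η ρ f)) (ball 0 1) :=
    contDiffOn_dZBar isOpen_ball hF (by norm_num)
  have hη' : ‖(starRingEnd ℂ) η‖ = 1 := by rw [norm_conj, hη]
  have hDn : ‖1 - (ρ : ℂ) ^ 2‖ = 1 - ρ ^ 2 := by
    rw [← ofReal_pow, ← ofReal_one, ← ofReal_sub, norm_real, Real.norm_of_nonneg hD.le]
  have hVn : ∀ u : ℂ, ‖1 - ρ * (starRingEnd ℂ) u‖ = ‖1 - ρ * u‖ := fun u => by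
    rw [← conj_one_sub_mul, norm_conj]
  have hN : ∀ u ∈ ball (0 : ℂ) 1, ‖dZ (dZ (dZBar (dZBar (bolTransform η ρ f)))) u‖ ≤
      γ * (1 - ρ ^ 2) ^ 3 * (1 - ρ * ‖u‖)⁻¹ ^ 6 := by
    intro u hu
    rw [bilaplacian_bolTransform hη hρ0.le hρ1 hf hu]
    simp only [norm_mul, norm_pow, norm_inv, hη, hη', hDn, hVn]
    have h1 := one_sub_le_norm hρ0.le u
    have h2 : 0 < 1 - ρ * ‖u‖ := by nlinarith [mem_ball_zero_iff.1 hu, norm_nonneg u]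
    have h3 : ‖1 - ρ * u‖⁻¹ ≤ (1 - ρ * ‖u‖)⁻¹ := by gcongr
    have h4 := hγ _ (mobius_mem_ball hη hρ0.le hρ1 hu)
    have h5 : ‖1 - ρ * u‖⁻¹ ^ 6 ≤ (1 - ρ * ‖u‖)⁻¹ ^ 6 := by gcongr
    have h6 := mul_le_mul h5 h4 (norm_nonneg _) (by positivity)
    calc _ = (1 - ρ ^ 2) ^ 3 * (‖1 - ρ * u‖⁻¹ ^ 6 *
            ‖dZ (dZ (dZBar (dZBar f))) (mobius η ρ u)‖) := by ring
      _ ≤ (1 - ρ ^ 2) ^ 3 * ((1 - ρ * ‖u‖)⁻¹ ^ 6 * γ) := by gcongr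
      _ = _ := by ring
  have key := norm_circleCoeff_sub_le hρ0 hρ1 (by positivity) hF hN hr
  -- Covariance supplies exactly the factor `(1-ρ²)³` that compensates `(1-ρr)⁻³`: their product is
  -- at most `2³`, uniformly in `r`. With `ρ ≥ 1/2` the constant is `256/15 ≤ 20`.
  have hsmall : 4 * Real.pi * (γ * (1 - ρ ^ 2) ^ 3) / (15 * ρ ^ 3) * (1 - ρ * r)⁻¹ ^ 3 ≤
      20 * Real.pi * γ := by
    have h1 : (1 - ρ * r)⁻¹ ≤ (1 - ρ)⁻¹ := by
      have : 0 < 1 - ρ := by linarith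
      gcongr
      nlinarith [hr.2]
    have h2 : (1 - ρ ^ 2) * (1 - ρ * r)⁻¹ ≤ 2 := by
      have h3 : 0 < 1 - ρ := by linarith
      calc (1 - ρ ^ 2) * (1 - ρ * r)⁻¹ ≤ (1 - ρ ^ 2) * (1 - ρ)⁻¹ := by gcongr
        _ = 1 + ρ := by field_simp; ring
        _ ≤ 2 := by linarith
    have h0 : 0 ≤ (1 - ρ ^ 2) * (1 - ρ * r)⁻¹ :=
      mul_nonneg hD.le (inv_nonneg.2 (by nlinarith [hr.1, hr.2]))
    have h3 : ((1 - ρ ^ 2) * (1 - ρ * r)⁻¹) ^ 3 ≤ 2 ^ 3 := by gcongr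
    have h4 : (1 / 2 : ℝ) ^ 3 ≤ ρ ^ 3 := by gcongr
    calc _ = 4 * Real.pi * γ * ((1 - ρ ^ 2) * (1 - ρ * r)⁻¹) ^ 3 / (15 * ρ ^ 3) := by ring
      _ ≤ 4 * Real.pi * γ * 2 ^ 3 / (15 * (1 / 2) ^ 3) := by gcongr
      _ ≤ 20 * Real.pi * γ := by
        have h5 : 0 ≤ Real.pi * γ := by positivity
        have h6 : 4 * Real.pi * γ * 2 ^ 3 / (15 * (1 / 2) ^ 3) = 256 / 15 * (Real.pi * γ) := by
          ring
        rw [h6]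
        linarith
  have hcf : Continuous fun θ : ℝ => (1 - ρ * circleMap 0 r θ) *
      f (mobius η ρ (circleMap 0 r θ)) := by
    refine (continuous_const.sub (continuous_const.mul (continuous_circleMap 0 r))).mul ?_
    refine continuous_comp_circleMap (c := 0) (R := 1) (v := fun u => f (mobius η ρ u)) ?_ hr'
    exact hf.continuousOn.comp ((continuousOn_mobius η hρ0.le hρ1).mono ball_subset_closedBall)
      fun u hu => mobius_mem_ball hη hρ0.le hρ1 hu
  set J : ℝ → ℂ := fun θ => (1 - ρ * circleMap 0 r θ) * f (mobius η ρ (circleMap 0 r θ)) with hJ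
  -- On the circle `(1-ρ²)(F - ū ∂̄F)` contains `f ∘ σ` with coefficient `(1-ρu)(1-ρū) + ρū(1-ρu) =
  -- 1-ρu`; what remains is the `∂̄f` term.
  have hdiff : (1 - (ρ : ℂ) ^ 2) * (circleCoeff 0 0 (bolTransform η ρ f) r -
      r * circleCoeff 0 1 (dZBar (bolTransform η ρ f)) r) - ∫ θ in -Real.pi..Real.pi, J θ =
      ∫ θ in -Real.pi..Real.pi, -((1 - (ρ : ℂ) ^ 2) * (starRingEnd ℂ) (circleMap 0 r θ) *
        ((1 - ρ * circleMap 0 r θ) * ((starRingEnd ℂ) η * dZBar f (mobius η ρ (circleMap 0 r θ)) *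
          (1 - ρ * (starRingEnd ℂ) (circleMap 0 r θ))⁻¹))) := by
    have i0 := (continuous_coeff_integrand (c := 0) 0 hF.continuousOn hr').intervalIntegrable
      (μ := MeasureTheory.volume) (-Real.pi) Real.pi
    have i1 := (continuous_coeff_integrand (c := 0) 1 hF1.continuousOn hr').intervalIntegrable
      (μ := MeasureTheory.volume) (-Real.pi) Real.pi
    unfold circleCoeff
    rw [← intervalIntegral.integral_const_mul, ← intervalIntegral.integral_sub i0
      (i1.const_mul _), ← intervalIntegral.integral_const_mul,
      ← intervalIntegral.integral_sub ((i0.sub (i1.const_mul _)).const_mul _)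
      (hcf.intervalIntegrable _ _)]
    congr 1
    ext θ
    have hu := circleMap_mem_ball_of_abs_lt (c := 0) hr' θ
    have hconj : (starRingEnd ℂ) (circleMap 0 r θ) = r * exp (-((1 : ℤ) : ℂ) * θ * I) := by
      simp only [circleMap, zero_add, map_mul, conj_ofReal, ← exp_conj, conj_I, Int.cast_one]
      congr 2; ring
    rw [hJ, dZBar_bolTransform hη hρ0.le hρ1 hf hu, bolTransform]
    have e2 : (1 - (ρ : ℂ) ^ 2) * (1 - (ρ : ℂ) ^ 2)⁻¹ = 1 :=
      mul_inv_cancel₀ (one_sub_sq_ne_zero hρ0.le hρ1)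
    have e3 : exp (-((0 : ℤ) : ℂ) * θ * I) = 1 := by simp
    simp only [e3]
    generalize (1 - (ρ : ℂ) ^ 2)⁻¹ = E at *
    generalize (1 - ρ * (starRingEnd ℂ) (circleMap 0 r θ))⁻¹ = V at *
    rw [hconj]
    generalize exp (-((1 : ℤ) : ℂ) * θ * I) = w
    linear_combination ((1 - ρ * circleMap 0 r θ) * f (mobius η ρ (circleMap 0 r θ))) * e2
  have hbd : ‖(1 - (ρ : ℂ) ^ 2) * (circleCoeff 0 0 (bolTransform η ρ f) r -
      r * circleCoeff 0 1 (dZBar (bolTransform η ρ f)) r) - ∫ θ in -Real.pi..Real.pi, J θ‖ ≤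
      (1 - ρ ^ 2) * (2 * Real.pi * K) := by
    rw [hdiff]
    have := intervalIntegral.norm_integral_le_of_norm_le_const
      (a := -Real.pi) (b := Real.pi) (C := (1 - ρ ^ 2) * K)
      (f := fun θ : ℝ => -((1 - (ρ : ℂ) ^ 2) * (starRingEnd ℂ) (circleMap 0 r θ) *
        ((1 - ρ * circleMap 0 r θ) * ((starRingEnd ℂ) η * dZBar f (mobius η ρ (circleMap 0 r θ)) *
          (1 - ρ * (starRingEnd ℂ) (circleMap 0 r θ))⁻¹)))) (fun θ _ => by
        have hu := circleMap_mem_ball_of_abs_lt (c := 0) hr' θ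
        have hW := norm_pos_iff.2
          (one_sub_mul_ne_zero hρ0.le hρ1 (mem_ball_zero_iff.1 hu).le)
        have hh := hK _ (mobius_mem_ball hη hρ0.le hρ1 hu)
        rw [norm_neg]
        -- The factors `1-ρu` and `(1-ρū)⁻¹` have reciprocal moduli, so no singularity is left as `ρ
        -- → 1`.
        simp only [norm_mul, norm_inv, hη', hDn, hVn, norm_conj]
        calc _ = (1 - ρ ^ 2) * ‖circleMap 0 r θ‖ *
              ‖dZBar f (mobius η ρ (circleMap 0 r θ))‖ := by field_simp
          _ ≤ (1 - ρ ^ 2) * 1 * K := by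
            have := (mem_ball_zero_iff.1 hu).le
            gcongr
          _ = _ := by ring)
    refine this.trans (le_of_eq ?_)
    rw [abs_of_nonneg (by linarith)]; ring
  have hF0 : (1 - (ρ : ℂ) ^ 2) * bolTransform η ρ f 0 = f (-(η * ρ)) := by
    rw [bolTransform, mobius_zero]
    have e2 : (1 - (ρ : ℂ) ^ 2) * (1 - (ρ : ℂ) ^ 2)⁻¹ = 1 :=
      mul_inv_cancel₀ (one_sub_sq_ne_zero hρ0.le hρ1)
    simp only [mul_zero, map_zero, sub_zero, one_mul]
    linear_combination f (-(η * ρ)) * e2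
  set Z := circleCoeff 0 0 (bolTransform η ρ f) r -
      r * circleCoeff 0 1 (dZBar (bolTransform η ρ f)) r
  have hsplit : (∫ θ in -Real.pi..Real.pi, J θ) - 2 * Real.pi * f (-(η * ρ)) =
      (1 - (ρ : ℂ) ^ 2) * (Z - 2 * Real.pi * bolTransform η ρ f 0) -
        ((1 - (ρ : ℂ) ^ 2) * Z - ∫ θ in -Real.pi..Real.pi, J θ) := by
    rw [← hF0]; ring
  rw [hsplit]
  refine (norm_sub_le _ _).trans ?_
  rw [norm_mul, hDn]
  have := mul_le_mul_of_nonneg_left (key.trans hsmall) hD.le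
  linarith

/-- Estimate of `f(-ηρ) - b` in terms of the boundary values of `f`. -/
theorem norm_sub_le_integral {f ψ : ℂ → ℂ} {η b : ℂ} {ρ γ K A : ℝ} {β : ℝ → ℝ} (hη : ‖η‖ = 1)
    (hρ : 1 / 2 ≤ ρ) (hρ1 : ρ < 1) (hf : ContDiffOn ℝ 4 f (ball 0 1))
    (hγ : ∀ z ∈ ball (0 : ℂ) 1, ‖dZ (dZ (dZBar (dZBar f))) z‖ ≤ γ)
    (hK : ∀ z ∈ ball (0 : ℂ) 1, ‖dZBar f z‖ ≤ K) (hA : ∀ z ∈ ball (0 : ℂ) 1, ‖f z‖ ≤ A)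
    (hψ : HasBoundaryValues f ψ)
    (hβ : ∀ θ ∈ Icc (-Real.pi) Real.pi, ‖ψ (mobius η ρ (circleMap 0 1 θ)) - b‖ ≤ β θ)
    (hβi : IntervalIntegrable β MeasureTheory.volume (-Real.pi) Real.pi) :
    2 * Real.pi * ‖f (-(η * ρ)) - b‖ ≤ 2 * (∫ θ in -Real.pi..Real.pi, β θ) +
      (1 - ρ ^ 2) * (2 * Real.pi * K + 20 * Real.pi * γ) := by
  have hπ := Real.pi_pos
  have hρ0 : 0 < ρ := by linarith
  -- Subtracting the constant changes neither `∂̄f` nor the bilaplacian, so the formula applies to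
  -- `f - b` with the same bounds.
  set f₁ : ℂ → ℂ := fun z => f z - b with hf₁
  have hbar : dZBar f₁ = dZBar f := by
    ext z; simp only [dZBar, hf₁, fderiv_sub_const]
  have hf1 : ContDiffOn ℝ 4 f₁ (ball 0 1) := hf.sub contDiffOn_const
  have key := fun r (hr : r ∈ Ico (0 : ℝ) 1) => norm_integral_sub_le (f := f₁) (γ := γ) (K := K)
    hη hρ hρ1 hf1 (by rwa [hbar]) (by rwa [hbar]) hr
  have hcirc : ∀ r ∈ Ico (0 : ℝ) 1, ∀ θ, circleMap 0 r θ ∈ ball (0 : ℂ) 1 := fun r hr θ =>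
    circleMap_mem_ball_of_abs_lt (by rw [abs_of_nonneg hr.1]; exact hr.2) θ
  have hA0 : 0 ≤ A := (norm_nonneg _).trans (hA 0 (mem_ball_self one_pos))
  have hev : ∀ᶠ r in 𝓝[<] (1 : ℝ), r ∈ Ico (0 : ℝ) 1 := Ico_mem_nhdsLT one_pos
  -- Passage `r → 1` by dominated convergence: `f` is bounded, and `σ` carries each radius into the
  -- disk with limit on the circle, where `f` tends to `ψ`.
  have hlim : Tendsto (fun r : ℝ => ∫ θ in -Real.pi..Real.pi, (1 - ρ * circleMap 0 r θ) *
      f₁ (mobius η ρ (circleMap 0 r θ))) (𝓝[<] 1) (𝓝 (∫ θ in -Real.pi..Real.pi,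
      (1 - ρ * circleMap 0 1 θ) * (ψ (mobius η ρ (circleMap 0 1 θ)) - b))) := by
    refine intervalIntegral.tendsto_integral_filter_of_dominated_convergence
      (fun _ => 2 * (A + ‖b‖)) ?_ ?_ intervalIntegrable_const ?_
    · filter_upwards [hev] with r hr
      refine Continuous.aestronglyMeasurable ?_
      refine (continuous_const.sub (continuous_const.mul (continuous_circleMap 0 r))).mul ?_
      refine (hf1.continuousOn.comp ((continuousOn_mobius η hρ0.le hρ1).mono
        ball_subset_closedBall) fun u hu => mobius_mem_ball hη hρ0.le hρ1 hu).comp_continuous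
        (continuous_circleMap 0 r) (hcirc r hr)
    · filter_upwards [hev] with r hr
      refine Eventually.of_forall fun θ _ => ?_
      rw [norm_mul]
      have hu := hcirc r hr θ
      exact mul_le_mul (norm_one_sub_mul_le hρ0.le hρ1 (mem_ball_zero_iff.1 hu).le)
        ((norm_sub_le _ _).trans (add_le_add_left (hA _ (mobius_mem_ball hη hρ0.le hρ1 hu)) _))
        (norm_nonneg _) zero_le_two
    · refine Eventually.of_forall fun θ _ => ?_
      have h1 : Tendsto (fun r : ℝ => circleMap 0 r θ) (𝓝[<] 1) (𝓝 (circleMap 0 1 θ)) := by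
        have : Continuous fun r : ℝ => circleMap 0 r θ := by unfold circleMap; fun_prop
        exact (this.tendsto 1).mono_left nhdsWithin_le_nhds
      have hs : circleMap 0 1 θ ∈ sphere (0 : ℂ) 1 := circleMap_mem_sphere 0 zero_le_one θ
      have h2 : Tendsto (fun r : ℝ => mobius η ρ (circleMap 0 r θ)) (𝓝[<] 1)
          (𝓝[ball 0 1] (mobius η ρ (circleMap 0 1 θ))) := by
        refine tendsto_nhdsWithin_iff.2 ⟨?_, ?_⟩
        · exact ((hasDerivAt_mobius η (one_sub_mul_ne_zero hρ0.le hρ1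
            (mem_sphere_zero_iff_norm.1 hs).le)).continuousAt.tendsto).comp h1
        · filter_upwards [hev] with r hr
          exact mobius_mem_ball hη hρ0.le hρ1 (hcirc r hr θ)
      have h3 := (hψ _ (mobius_mem_sphere hη hρ0.le hρ1 hs)).comp h2
      exact (tendsto_const_nhds.sub (tendsto_const_nhds.mul h1)).mul (h3.sub_const b)
  have hle := le_of_tendsto ((hlim.sub_const (2 * Real.pi * f₁ (-(η * ρ)))).norm)
    (hev.mono key)
  have hint : ‖∫ θ in -Real.pi..Real.pi, (1 - ρ * circleMap 0 1 θ) *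
      (ψ (mobius η ρ (circleMap 0 1 θ)) - b)‖ ≤ ∫ θ in -Real.pi..Real.pi, 2 * β θ := by
    refine intervalIntegral.norm_integral_le_of_norm_le (by linarith) ?_ (hβi.const_mul 2)
    refine Eventually.of_forall fun θ hθ => ?_
    rw [norm_mul]
    exact mul_le_mul (norm_one_sub_mul_le hρ0.le hρ1 (by simp))
      (hβ θ (Ioc_subset_Icc_self hθ)) (norm_nonneg _) zero_le_two
  rw [intervalIntegral.integral_const_mul] at hint
  have hfin : ‖2 * Real.pi * f₁ (-(η * ρ))‖ = 2 * Real.pi * ‖f (-(η * ρ)) - b‖ := by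
    rw [norm_mul, norm_mul, Complex.norm_ofNat, norm_real, Real.norm_of_nonneg hπ.le]
  rw [← hfin]
  have := norm_le_norm_add_norm_sub' (2 * Real.pi * f₁ (-(η * ρ)))
    (∫ θ in -Real.pi..Real.pi, (1 - ρ * circleMap 0 1 θ) *
      (ψ (mobius η ρ (circleMap 0 1 θ)) - b))
  rw [norm_sub_rev] at this
  linarith

/-! ### Majorants and the Hardy–Littlewood integral -/

namespace IsMajorant

variable {ω : ℝ → ℝ}

theorem nonneg (h : IsMajorant ω) {t : ℝ} (ht : 0 ≤ t) : 0 ≤ ω t := by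
  rw [← h.map_zero]
  exact h.monotoneOn (mem_Ici.2 le_rfl) ht ht

theorem mul_le_mul (h : IsMajorant ω) {s t : ℝ} (hs : 0 < s) (hst : s ≤ t) :
    ω t * s ≤ ω s * t := by
  have h1 : ω t / t ≤ ω s / s := h.antitoneOn_div hs (hs.trans_le hst) hst
  rwa [div_le_div_iff₀ (hs.trans_le hst) hs] at h1

theorem map_mul_le (h : IsMajorant ω) {c t : ℝ} (hc : 1 ≤ c) (ht : 0 ≤ t) :
    ω (c * t) ≤ c * ω t := by
  rcases ht.eq_or_lt with rfl | h0
  · simp [h.map_zero]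
  · have := h.mul_le_mul h0 (show t ≤ c * t by nlinarith)
    refine le_of_mul_le_mul_right (this.trans (le_of_eq ?_)) h0
    ring

theorem add_id (h : IsMajorant ω) : IsMajorant fun t => ω t + t where
  continuousOn := h.continuousOn.add continuousOn_id
  monotoneOn := h.monotoneOn.add monotoneOn_id
  map_zero := by simp [h.map_zero]
  antitoneOn_div := fun s hs t ht hst => by
    have h1 : ω t / t ≤ ω s / s := h.antitoneOn_div hs ht hst
    have hs' : s ≠ 0 := (mem_Ioi.1 hs).ne'
    have ht' : t ≠ 0 := (mem_Ioi.1 ht).ne'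
    simp only [add_div, div_self hs', div_self ht']
    linarith

/-- Since `t/ω(t)` is non-decreasing where it makes sense, its value at an endpoint bounds it; `max
a 2` lies beyond both the whole range and a point where `ω` is positive. -/
theorem exists_mul_le (h : IsMajorant ω) (hne : ∃ t : ℝ, 0 < t ∧ ω t ≠ 0) :
    ∃ C : ℝ, 0 < C ∧ ∀ t, 0 ≤ t → t ≤ 2 → t ≤ C * ω t := by
  obtain ⟨a, ha, hωa⟩ := hne
  have hpos : 0 < ω a := lt_of_le_of_ne (h.nonneg ha.le) hωa.symm
  have hb : 0 < ω (max a 2) := hpos.trans_le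
    (h.monotoneOn (mem_Ici.2 ha.le) (mem_Ici.2 (ha.le.trans (le_max_left _ _))) (le_max_left _ _))
  refine ⟨max a 2 / ω (max a 2), by positivity, fun t ht ht2 => ?_⟩
  rcases ht.eq_or_lt with rfl | h0
  · simp [h.map_zero]
  · have := h.mul_le_mul h0 (ht2.trans (le_max_right a 2))
    rw [div_mul_eq_mul_div, le_div_iff₀ hb]
    linarith

/-- The substitution `t ↦ πd/t` exchanges the endpoints `d` and `π`. -/
theorem integral_comp_div (h : IsMajorant ω) {d : ℝ} (hd : 0 < d) (hdπ : d ≤ Real.pi) :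
    ∫ t in d..Real.pi, ω (Real.pi * d / t) =
      Real.pi * d * ∫ t in d..Real.pi, ω t / t ^ 2 := by
  have hπ := Real.pi_pos
  have hI : uIcc d Real.pi = Icc d Real.pi := uIcc_of_le hdπ
  have hpos : ∀ t ∈ Icc d Real.pi, 0 < t := fun t ht => hd.trans_le ht.1
  have key := intervalIntegral.integral_comp_mul_deriv'' (a := d) (b := Real.pi)
    (f := fun t => Real.pi * d / t) (f' := fun t => -(Real.pi * d / t ^ 2))
    (g := fun t => ω t / t ^ 2) ?_ ?_ ?_ ?_
  · have e1 : ∀ t ∈ uIcc d Real.pi, ω (Real.pi * d / t) = -(Real.pi * d) *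
        (((fun t => ω t / t ^ 2) ∘ fun t => Real.pi * d / t) t * -(Real.pi * d / t ^ 2)) := by
      intro t ht
      rw [hI] at ht
      have := (hpos t ht).ne'
      simp only [Function.comp]
      field_simp
    rw [intervalIntegral.integral_congr e1, intervalIntegral.integral_const_mul, key]
    have e2 : Real.pi * d / d = Real.pi := by field_simp
    have e3 : Real.pi * d / Real.pi = d := by field_simp
    rw [e2, e3, intervalIntegral.integral_symm]
    ring
  · rw [hI]
    exact continuousOn_const.div continuousOn_id fun t ht => (hpos t ht).ne'
  · intro t ht
    rw [min_eq_left hdπ, max_eq_right hdπ] at ht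
    have h0 := (hpos t (Ioo_subset_Icc_self ht)).ne'
    have := ((hasDerivAt_inv h0).const_mul (Real.pi * d)).hasDerivWithinAt (s := Ioi t)
    refine this.congr_deriv ?_
    field_simp
  · rw [hI]
    exact (continuousOn_const.div (continuousOn_id.pow 2) fun t ht =>
      (pow_pos (hpos t ht) 2).ne').neg
  · rw [hI]
    have hsub : (fun t => Real.pi * d / t) '' Icc d Real.pi ⊆ Ioi 0 := by
      rintro _ ⟨t, ht, rfl⟩
      have := hpos t ht
      exact mem_Ioi.2 (by positivity)
    exact (h.continuousOn.mono (hsub.trans Ioi_subset_Ici_self)).div (continuousOn_id.pow 2)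
      fun t ht => (pow_pos (mem_Ioi.1 (hsub ht)) 2).ne'

theorem continuous_comp_div_max (h : IsMajorant ω) {d : ℝ} (hd : 0 < d) :
    Continuous fun t : ℝ => ω (Real.pi * d / max |t| d) := by
  have hπ := Real.pi_pos
  have hm : ∀ t : ℝ, 0 < max |t| d := fun t => hd.trans_le (le_max_right _ _)
  refine h.continuousOn.comp_continuous (continuous_const.div (by fun_prop)
    fun t => (hm t).ne') fun t => ?_
  have := hm t
  exact mem_Ici.2 (by positivity)

/-- By evenness the integral is twice that over `[0, π]`. The piece `[0, d]` gives `d ω(π) ≤ π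
ω(d)`, and the piece `[d, π]` is the Hardy–Littlewood integral. -/
theorem integral_comp_div_max_le (h : IsMajorant ω) {M d : ℝ} (hd : 0 < d) (hdπ : d ≤ Real.pi)
    (hM : d * (∫ t in d..Real.pi, ω t / t ^ 2) ≤ M * ω d) :
    ∫ t in -Real.pi..Real.pi, ω (Real.pi * d / max |t| d) ≤ 2 * Real.pi * (1 + M) * ω d := by
  have hπ := Real.pi_pos
  have hc := h.continuous_comp_div_max hd
  have hi := fun a b => hc.intervalIntegrable (μ := MeasureTheory.volume) a b
  have e1 : ∫ t in -Real.pi..0, ω (Real.pi * d / max |t| d) =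
      ∫ t in 0..Real.pi, ω (Real.pi * d / max |t| d) := by
    have := intervalIntegral.integral_comp_neg (a := 0) (b := Real.pi)
      (fun t => ω (Real.pi * d / max |t| d))
    simp only [abs_neg, neg_zero] at this
    exact this.symm
  have e2 : ∫ t in (0 : ℝ)..d, ω (Real.pi * d / max |t| d) = d * ω Real.pi := by
    have : ∀ t ∈ uIcc 0 d, ω (Real.pi * d / max |t| d) = ω Real.pi := by
      intro t ht
      rw [uIcc_of_le hd.le] at ht
      rw [abs_of_nonneg ht.1, max_eq_right ht.2]
      congr 1
      field_simp
    rw [intervalIntegral.integral_congr this, intervalIntegral.integral_const]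
    simp
  have e3 : ∫ t in d..Real.pi, ω (Real.pi * d / max |t| d) =
      Real.pi * d * ∫ t in d..Real.pi, ω t / t ^ 2 := by
    rw [← h.integral_comp_div hd hdπ]
    refine intervalIntegral.integral_congr fun t ht => ?_
    rw [uIcc_of_le hdπ] at ht
    simp only [abs_of_nonneg (hd.le.trans ht.1), max_eq_left ht.1]
  have e4 := h.mul_le_mul hd hdπ
  rw [← intervalIntegral.integral_add_adjacent_intervals (hi _ 0) (hi _ _), e1,
    ← intervalIntegral.integral_add_adjacent_intervals (hi _ d) (hi _ _), e2, e3]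
  nlinarith

end IsMajorant

/-! ### Boundary estimate -/

/-- From `|1-ρe^{iθ}|² = (1-ρ)² + 2ρ(1-cos θ)` and `1 - cos θ ≥ 2θ²/π²`. -/
theorem abs_le_mul_norm_one_sub_exp {ρ θ : ℝ} (hρ : 1 / 2 ≤ ρ) (hθ : |θ| ≤ Real.pi) :
    |θ| ≤ Real.pi * ‖1 - ρ * circleMap 0 1 θ‖ := by
  have hπ := Real.pi_pos
  have h1 : ‖1 - ρ * circleMap 0 1 θ‖ ^ 2 = (1 - ρ) ^ 2 + 2 * ρ * (1 - Real.cos θ) := by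
    rw [← normSq_eq_norm_sq, normSq_apply, circleMap, exp_mul_I, ← ofReal_cos, ← ofReal_sin]
    simp
    rw [Complex.cos_ofReal_re, Complex.sin_ofReal_re]
    linear_combination ρ ^ 2 * Real.sin_sq_add_cos_sq θ
  have h2 := Real.cos_le_one_sub_mul_cos_sq hθ
  have h3 : θ ^ 2 ≤ (Real.pi * ‖1 - ρ * circleMap 0 1 θ‖) ^ 2 := by
    have h4 : 2 / Real.pi ^ 2 * θ ^ 2 ≤ 1 - Real.cos θ := by linarith
    rw [mul_pow, h1]
    have h5 : 2 * θ ^ 2 ≤ Real.pi ^ 2 * (1 - Real.cos θ) := by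
      rw [div_mul_eq_mul_div, div_le_iff₀ (by positivity)] at h4
      linarith
    have h6 : 0 ≤ 1 - Real.cos θ := by linarith [Real.cos_le_one θ]
    have h7 : Real.pi ^ 2 * (1 - Real.cos θ) ≤ Real.pi ^ 2 * (2 * ρ * (1 - Real.cos θ)) := by
      gcongr
      nlinarith
    nlinarith [sq_nonneg (Real.pi * (1 - ρ)), sq_nonneg θ]
  exact abs_le_of_sq_le_sq h3 (by positivity)

/-- `σ(u) + η = η(1-ρ)(1+u)/(1-ρu)`, whose denominator is at least `max(|θ|, 1-ρ)/π` in modulus. So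
the image of the circle stays near `-η` except for `u` near `1`. -/
theorem norm_mobius_add_le {η : ℂ} {ρ θ : ℝ} (hη : ‖η‖ = 1) (hρ : 1 / 2 ≤ ρ) (hρ1 : ρ < 1)
    (hθ : |θ| ≤ Real.pi) :
    ‖mobius η ρ (circleMap 0 1 θ) - -η‖ ≤ 2 * (Real.pi * (1 - ρ) / max |θ| (1 - ρ)) := by
  have hπ := Real.pi_pos
  have hρ0 : 0 ≤ ρ := by linarith
  have hd : 0 < 1 - ρ := by linarith
  have hu : ‖circleMap 0 1 θ‖ = 1 := by simp
  have hne := one_sub_mul_ne_zero hρ0 hρ1 hu.le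
  have e : mobius η ρ (circleMap 0 1 θ) - -η =
      η * ((1 - ρ : ℝ) : ℂ) * (1 + circleMap 0 1 θ) * (1 - ρ * circleMap 0 1 θ)⁻¹ := by
    have := mul_inv_cancel₀ hne
    rw [mobius]
    push_cast
    linear_combination (-η) * this
  have h1 := abs_le_mul_norm_one_sub_exp hρ hθ
  have h2 := one_sub_le_norm hρ0 (circleMap 0 1 θ)
  rw [hu, mul_one] at h2
  have h3 : max |θ| (1 - ρ) ≤ Real.pi * ‖1 - ρ * circleMap 0 1 θ‖ := by
    refine max_le h1 (h2.trans ?_)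
    have := Real.pi_gt_three
    nlinarith [norm_nonneg (1 - ρ * circleMap 0 1 θ)]
  have h4 : ‖1 + circleMap 0 1 θ‖ ≤ 2 := by
    refine (norm_add_le _ _).trans ?_
    rw [hu, norm_one]; norm_num
  have h5 := norm_pos_iff.2 hne
  have h6 : 0 < max |θ| (1 - ρ) := hd.trans_le (le_max_right _ _)
  rw [e, norm_mul, norm_mul, norm_mul, hη, one_mul, norm_real, Real.norm_of_nonneg hd.le, norm_inv,
    ← div_eq_mul_inv, ← mul_div_assoc, div_le_div_iff₀ h5 h6]
  calc (1 - ρ) * ‖1 + circleMap 0 1 θ‖ * max |θ| (1 - ρ) ≤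
      (1 - ρ) * 2 * (Real.pi * ‖1 - ρ * circleMap 0 1 θ‖) := by gcongr
    _ = _ := by ring

/-- Each point of the closed disk has a neighbourhood on whose trace in the open disk `u` is
bounded; finitely many of these cover. -/
theorem HasBoundaryValues.exists_norm_le {u h : ℂ → ℂ} (hu : HasBoundaryValues u h)
    (hc : ContinuousOn u (ball 0 1)) : ∃ A : ℝ, ∀ z ∈ ball (0 : ℂ) 1, ‖u z‖ ≤ A := by
  have key : ∃ A : ℝ, ∀ z ∈ closedBall (0 : ℂ) 1 ∩ ball 0 1, ‖u z‖ ≤ A := by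
    refine (isCompact_closedBall (0 : ℂ) 1).induction_on
      (p := fun s => ∃ A : ℝ, ∀ z ∈ s ∩ ball (0 : ℂ) 1, ‖u z‖ ≤ A) ⟨0, by simp⟩ ?_ ?_ ?_
    · rintro s t hst ⟨A, hA⟩
      exact ⟨A, fun z hz => hA z ⟨hst hz.1, hz.2⟩⟩
    · rintro s t ⟨A, hA⟩ ⟨B, hB⟩
      refine ⟨max A B, fun z hz => ?_⟩
      rcases hz.1 with h1 | h1
      · exact (hA z ⟨h1, hz.2⟩).trans (le_max_left _ _)
      · exact (hB z ⟨h1, hz.2⟩).trans (le_max_right _ _)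
    · intro ζ hζ
      have hlim : ∃ a, Tendsto u (𝓝[ball (0 : ℂ) 1] ζ) (𝓝 a) := by
        rcases (mem_closedBall_zero_iff.1 hζ).lt_or_eq with h1 | h1
        · exact ⟨_, hc ζ (mem_ball_zero_iff.2 h1)⟩
        · exact ⟨_, hu ζ (mem_sphere_zero_iff_norm.2 h1)⟩
      obtain ⟨a, ha⟩ := hlim
      have hev : ∀ᶠ z in 𝓝[ball (0 : ℂ) 1] ζ, ‖u z‖ ≤ ‖a‖ + 1 :=
        (ha.norm.eventually_lt_const (lt_add_one ‖a‖)).mono fun _ h => h.le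
      rw [eventually_nhdsWithin_iff] at hev
      exact ⟨_, mem_nhdsWithin_of_mem_nhds hev, ‖a‖ + 1, fun z hz => hz.1 hz.2⟩
  obtain ⟨A, hA⟩ := key
  exact ⟨A, fun z hz => hA z ⟨ball_subset_closedBall hz, hz⟩⟩

/-- Distance of `f` from its boundary values. -/
theorem exists_norm_sub_boundary_le {f ψ : ℂ → ℂ} {ω : ℝ → ℝ} {γ K A : ℝ} (hω : IsMajorant ω)
    (hHL : HardyLittlewoodCondition ω) (hψ : MemLipschitzSpace ω (sphere 0 1) ψ)
    (hf : ContDiffOn ℝ 4 f (ball 0 1))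
    (hγ : ∀ z ∈ ball (0 : ℂ) 1, ‖dZ (dZ (dZBar (dZBar f))) z‖ ≤ γ)
    (hK : ∀ z ∈ ball (0 : ℂ) 1, ‖dZBar f z‖ ≤ K) (hA : ∀ z ∈ ball (0 : ℂ) 1, ‖f z‖ ≤ A)
    (hbv : HasBoundaryValues f ψ) :
    ∃ C : ℝ, 0 < C ∧ ∀ ζ : ℂ, ‖ζ‖ = 1 → ∀ ρ : ℝ, 0 ≤ ρ → ρ < 1 →
      ‖f (ζ * ρ) - ψ ζ‖ ≤ C * (ω (1 - ρ) + (1 - ρ)) := by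
  have hπ := Real.pi_pos
  have hπ3 := Real.pi_gt_three
  obtain ⟨M, hM, hM'⟩ := hHL
  obtain ⟨N, hN, hN'⟩ := hψ
  have hb0 : (0 : ℂ) ∈ ball (0 : ℂ) 1 := mem_ball_self one_pos
  have hγ0 : 0 ≤ γ := (norm_nonneg _).trans (hγ 0 hb0)
  have hK0 : 0 ≤ K := (norm_nonneg _).trans (hK 0 hb0)
  have hA0 : 0 ≤ A := (norm_nonneg _).trans (hA 0 hb0)
  -- The constant left after dividing by `2π`: the factor 4 is 2 from the kernel `1-ρu` and 2 from
  -- `ω(2X) ≤ 2ω(X)`; the rest uses `1-ρ² ≤ 2(1-ρ)`.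
  set C₁ := 4 * N * (1 + M) + 2 * K + 20 * γ
  have hC₁ : 0 < C₁ := by positivity
  have key : ∀ ζ : ℂ, ‖ζ‖ = 1 → ∀ ρ : ℝ, 1 / 2 ≤ ρ → ρ < 1 →
      ‖f (ζ * ρ) - ψ ζ‖ ≤ C₁ * (ω (1 - ρ) + (1 - ρ)) := by
    intro ζ hζ ρ hρ hρ1
    have hd : 0 < 1 - ρ := by linarith
    have hη : ‖-ζ‖ = 1 := by rw [norm_neg, hζ]
    have h := norm_sub_le_integral (η := -ζ) (b := ψ ζ)
      (β := fun θ => 2 * N * ω (Real.pi * (1 - ρ) / max |θ| (1 - ρ))) hη hρ hρ1 hf hγ hK hA hbv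
      (fun θ hθ => by
        have h1 := norm_mobius_add_le hη hρ hρ1 (abs_le.2 hθ)
        rw [neg_neg] at h1
        have h2 := hN' (mobius (-ζ) ρ (circleMap 0 1 θ)) (mobius_mem_sphere hη (by linarith) hρ1
          (circleMap_mem_sphere 0 zero_le_one θ)) ζ (mem_sphere_zero_iff_norm.2 hζ)
        have hX : 0 ≤ Real.pi * (1 - ρ) / max |θ| (1 - ρ) := by positivity
        have h3 := hω.monotoneOn (mem_Ici.2 (norm_nonneg _)) (mem_Ici.2 (by positivity)) h1
        have h4 := hω.map_mul_le one_le_two hX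
        nlinarith)
      (((hω.continuous_comp_div_max hd).const_mul (2 * N)).intervalIntegrable _ _)
    rw [intervalIntegral.integral_const_mul, neg_mul, neg_neg] at h
    have h1 := hω.integral_comp_div_max_le hd (by linarith) (hM' _ hd (by linarith))
    have h2 : 1 - ρ ^ 2 ≤ 2 * (1 - ρ) := by nlinarith
    have hω0 := hω.nonneg hd.le
    have h3 : (1 - ρ ^ 2) * (2 * Real.pi * K + 20 * Real.pi * γ) ≤
        2 * (1 - ρ) * (2 * Real.pi * K + 20 * Real.pi * γ) := by gcongr
    have h4 := mul_le_mul_of_nonneg_left h1 (show 0 ≤ 2 * (2 * N) by positivity)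
    have h5 : 2 * Real.pi * ‖f (ζ * ρ) - ψ ζ‖ ≤ 2 * Real.pi * (4 * N * (1 + M) * ω (1 - ρ) +
        (2 * K + 20 * γ) * (1 - ρ)) := by linarith
    have h6 := le_of_mul_le_mul_left h5 (by positivity)
    refine h6.trans ?_
    have h7 : 0 ≤ 4 * N * (1 + M) * (1 - ρ) := by positivity
    have h8 : 0 ≤ (2 * K + 20 * γ) * ω (1 - ρ) := by positivity
    simp only [C₁]
    linarith
  refine ⟨C₁ + 4 * A, by positivity, fun ζ hζ ρ hρ0 hρ1 => ?_⟩
  have hω0 := hω.nonneg (show 0 ≤ 1 - ρ by linarith)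
  rcases le_or_gt (1 / 2) ρ with hρ | hρ
  · have := key ζ hζ ρ hρ hρ1
    nlinarith
  -- For `ρ < 1/2` one compares with the radius `1/2`; the loss `2A` is at most `4A(1-ρ)`.
  · have h1 := key ζ hζ (1 / 2) le_rfl (by norm_num)
    have hmem : ∀ t : ℝ, 0 ≤ t → t < 1 → ζ * t ∈ ball (0 : ℂ) 1 := fun t ht ht1 => by
      rw [mem_ball_zero_iff, norm_mul, hζ, one_mul, norm_real, Real.norm_of_nonneg ht]
      exact ht1
    have h2 := hA _ (hmem ρ hρ0 hρ1)
    have h3 := hA _ (hmem (1 / 2) (by norm_num) (by norm_num))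
    have h4 : ω (1 - 1 / 2) ≤ ω (1 - ρ) :=
      hω.monotoneOn (mem_Ici.2 (by norm_num)) (mem_Ici.2 (by linarith)) (by linarith)
    have h5 : ‖f (ζ * ρ) - ψ ζ‖ ≤ ‖f (ζ * ρ)‖ + ‖f (ζ * (1 / 2 : ℝ))‖ +
        ‖f (ζ * (1 / 2 : ℝ)) - ψ ζ‖ := by
      calc ‖f (ζ * ρ) - ψ ζ‖ = ‖(f (ζ * ρ) - f (ζ * (1 / 2 : ℝ))) +
            (f (ζ * (1 / 2 : ℝ)) - ψ ζ)‖ := by congr 1; ring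
        _ ≤ _ := (norm_add_le _ _).trans (add_le_add_left (norm_sub_le _ _) _)
    have h6 : C₁ * (ω (1 - 1 / 2) + (1 - 1 / 2)) ≤ C₁ * (ω (1 - ρ) + (1 - ρ)) := by
      gcongr
    have h7 : 2 * A ≤ 4 * A * (ω (1 - ρ) + (1 - ρ)) := by nlinarith
    linarith

/-! ### The bilaplacian in Wirtinger derivatives -/

section Bilaplacian

variable {f : ℂ → ℂ} {U : Set ℂ}

theorem bilaplacian_eq_dZBar_dZ (hU : IsOpen U) (hf : ContDiffOn ℝ 4 f U) {z : ℂ} (hz : z ∈ U) :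
    Δ (Δ f) z = 16 * dZBar (dZ (dZBar (dZ f))) z := by
  have hk : ContDiffOn ℝ 2 (dZBar (dZ f)) U :=
    contDiffOn_dZBar hU (contDiffOn_dZ (m := 3) hU hf (by norm_num)) (by norm_num)
  have h1 : Δ f =ᶠ[𝓝 z] (4 : ℂ) • dZBar (dZ f) := by
    filter_upwards [hU.mem_nhds hz] with w hw
    exact laplacian_eq_dZBar_dZ ((hf.contDiffAt (hU.mem_nhds hw)).of_le (by norm_num))
  have hkz := hk.contDiffAt (hU.mem_nhds hz)
  rw [(InnerProductSpace.laplacian_congr_nhds h1).eq_of_nhds,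
    InnerProductSpace.laplacian_smul _ hkz, laplacian_eq_dZBar_dZ hkz, smul_eq_mul]
  ring

/-- The interior estimate uses the order `∂̄∂∂̄∂`, the Möbius argument the order `∂∂∂̄∂̄`. -/
theorem dZ_dZ_dZBar_dZBar (hU : IsOpen U) (hf : ContDiffOn ℝ 4 f U) {z : ℂ} (hz : z ∈ U) :
    dZ (dZ (dZBar (dZBar f))) z = dZBar (dZ (dZBar (dZ f))) z := by
  have h1 : ContDiffOn ℝ 3 (dZBar f) U := contDiffOn_dZBar hU hf (by norm_num)
  have hk : ContDiffOn ℝ 2 (dZBar (dZ f)) U :=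
    contDiffOn_dZBar hU (contDiffOn_dZ (m := 3) hU hf (by norm_num)) (by norm_num)
  have e1 : ∀ w ∈ U, dZ (dZBar f) w = dZBar (dZ f) w := fun w hw =>
    dZ_dZBar_comm ((hf.contDiffAt (hU.mem_nhds hw)).of_le (by norm_num))
  have e2 : ∀ w ∈ U, dZ (dZBar (dZBar f)) w = dZBar (dZBar (dZ f)) w := fun w hw => by
    rw [dZ_dZBar_comm ((h1.contDiffAt (hU.mem_nhds hw)).of_le (by norm_num))]
    exact dZBar_congr (eventually_of_mem (hU.mem_nhds hw) e1)
  rw [dZ_congr (eventually_of_mem (hU.mem_nhds hz) e2)]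
  exact dZ_dZBar_comm (hk.contDiffAt (hU.mem_nhds hz))

end Bilaplacian

/-! ### From the boundary to the whole disk -/

theorem norm_fderiv_le (f : ℂ → ℂ) (z : ℂ) : ‖fderiv ℝ f z‖ ≤ ‖dZ f z‖ + ‖dZBar f z‖ := by
  refine ContinuousLinearMap.opNorm_le_bound _ (by positivity) fun w => ?_
  have h : fderiv ℝ f z w = wirtingerCLM (dZ f z) (dZBar f z) w :=
    congrArg (fun L : ℂ →L[ℝ] ℂ => L w) (clm_eq_wirtingerCLM (fderiv ℝ f z))
  rw [h, wirtingerCLM_apply]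
  refine (norm_add_le _ _).trans (le_of_eq ?_)
  rw [norm_mul, norm_mul, norm_conj]
  ring

theorem exists_eq_mul_norm (z : ℂ) : ∃ ζ : ℂ, ‖ζ‖ = 1 ∧ z = ζ * ‖z‖ := by
  refine ⟨exp (arg z * I), norm_exp_ofReal_mul_I _, ?_⟩
  rw [mul_comm]
  exact (norm_mul_exp_arg_mul_I z).symm

/-- Comparison of two points through the boundary. -/
theorem norm_sub_le_of_boundary {f ψ : ℂ → ℂ} {W : ℝ → ℝ} {C N : ℝ} (hW : IsMajorant W)
    (hC : 0 ≤ C) (hN : 0 ≤ N)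
    (hf : ∀ ζ : ℂ, ‖ζ‖ = 1 → ∀ ρ : ℝ, 0 ≤ ρ → ρ < 1 → ‖f (ζ * ρ) - ψ ζ‖ ≤ C * W (1 - ρ))
    (hψ : ∀ ζ₁ ∈ sphere (0 : ℂ) 1, ∀ ζ₂ ∈ sphere (0 : ℂ) 1, ‖ψ ζ₁ - ψ ζ₂‖ ≤ N * W ‖ζ₁ - ζ₂‖)
    {z₁ z₂ : ℂ} {L : ℝ} (h₁ : z₁ ∈ ball (0 : ℂ) 1) (h₂ : z₂ ∈ ball (0 : ℂ) 1)
    (hL₁ : 1 - ‖z₁‖ ≤ L) (hL₂ : 1 - ‖z₂‖ ≤ L) (hL : ‖z₁ - z₂‖ ≤ L) :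
    ‖f z₁ - f z₂‖ ≤ (2 * C + 3 * N) * W L := by
  rw [mem_ball_zero_iff] at h₁ h₂
  have hL0 : 0 ≤ L := (norm_nonneg _).trans hL
  obtain ⟨ζ₁, hζ₁, e₁⟩ := exists_eq_mul_norm z₁
  obtain ⟨ζ₂, hζ₂, e₂⟩ := exists_eq_mul_norm z₂
  have b₁ := hf ζ₁ hζ₁ _ (norm_nonneg _) h₁
  have b₂ := hf ζ₂ hζ₂ _ (norm_nonneg _) h₂
  rw [← e₁] at b₁
  rw [← e₂] at b₂
  have b₃ := hψ ζ₁ (mem_sphere_zero_iff_norm.2 hζ₁) ζ₂ (mem_sphere_zero_iff_norm.2 hζ₂)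
  have hdist : ∀ z ζ : ℂ, ‖ζ‖ = 1 → z = ζ * ‖z‖ → ‖z‖ < 1 → ‖ζ - z‖ = 1 - ‖z‖ := by
    intro z ζ hζ e hz
    have : ζ - z = ζ * ((1 - ‖z‖ : ℝ) : ℂ) := by push_cast; linear_combination -e
    rw [this, norm_mul, hζ, one_mul, norm_real, Real.norm_of_nonneg (by linarith)]
  have m₁ : W (1 - ‖z₁‖) ≤ W L :=
    hW.monotoneOn (mem_Ici.2 (by linarith)) (mem_Ici.2 hL0) hL₁
  have m₂ : W (1 - ‖z₂‖) ≤ W L :=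
    hW.monotoneOn (mem_Ici.2 (by linarith)) (mem_Ici.2 hL0) hL₂
  -- The path from `ζ₁` through `z₁` and `z₂` to `ζ₂` has three legs, each of length at most `L`.
  have m₃ : ‖ζ₁ - ζ₂‖ ≤ 3 * L := by
    have : ζ₁ - ζ₂ = (ζ₁ - z₁) + (z₁ - z₂) - (ζ₂ - z₂) := by ring
    rw [this]
    refine (norm_sub_le _ _).trans ?_
    have := norm_add_le (ζ₁ - z₁) (z₁ - z₂)
    rw [hdist z₁ ζ₁ hζ₁ e₁ h₁] at this
    rw [hdist z₂ ζ₂ hζ₂ e₂ h₂]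
    linarith
  have m₄ : W ‖ζ₁ - ζ₂‖ ≤ 3 * W L :=
    (hW.monotoneOn (mem_Ici.2 (norm_nonneg _)) (mem_Ici.2 (by linarith)) m₃).trans
      (hW.map_mul_le (by norm_num) hL0)
  calc ‖f z₁ - f z₂‖ = ‖(f z₁ - ψ ζ₁) + (ψ ζ₁ - ψ ζ₂) - (f z₂ - ψ ζ₂)‖ := by congr 1; ring
    _ ≤ ‖f z₁ - ψ ζ₁‖ + ‖ψ ζ₁ - ψ ζ₂‖ + ‖f z₂ - ψ ζ₂‖ :=
      (norm_sub_le _ _).trans (add_le_add_left (norm_add_le _ _) _)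
    _ ≤ C * W L + N * (3 * W L) + C * W L := by
      refine add_le_add (add_le_add (b₁.trans ?_) (b₃.trans ?_)) (b₂.trans ?_) <;> gcongr
    _ = _ := by ring

/-- Lipschitz estimate in the disk from the boundary estimate and the interior estimate. -/
theorem exists_lipschitz_of_boundary {f ψ : ℂ → ℂ} {W : ℝ → ℝ} {C N γ K : ℝ} (hW : IsMajorant W)
    (hWt : ∀ t, 0 ≤ t → t ≤ W t) (hC : 0 ≤ C) (hN : 0 ≤ N) (hfd : ContDiffOn ℝ 4 f (ball 0 1))
    (hγ : ∀ z ∈ ball (0 : ℂ) 1, ‖dZBar (dZ (dZBar (dZ f))) z‖ ≤ γ)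
    (hK : ∀ z ∈ ball (0 : ℂ) 1, ‖dZBar f z‖ ≤ K)
    (hf : ∀ ζ : ℂ, ‖ζ‖ = 1 → ∀ ρ : ℝ, 0 ≤ ρ → ρ < 1 → ‖f (ζ * ρ) - ψ ζ‖ ≤ C * W (1 - ρ))
    (hψ : ∀ ζ₁ ∈ sphere (0 : ℂ) 1, ∀ ζ₂ ∈ sphere (0 : ℂ) 1, ‖ψ ζ₁ - ψ ζ₂‖ ≤ N * W ‖ζ₁ - ζ₂‖) :
    ∃ M : ℝ, 0 ≤ M ∧ ∀ z₁ ∈ ball (0 : ℂ) 1, ∀ z₂ ∈ ball (0 : ℂ) 1,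
      ‖f z₁ - f z₂‖ ≤ M * W ‖z₁ - z₂‖ := by
  have hb0 : (0 : ℂ) ∈ ball (0 : ℂ) 1 := mem_ball_self one_pos
  have hγ0 : 0 ≤ γ := (norm_nonneg _).trans (hγ 0 hb0)
  have hK0 : 0 ≤ K := (norm_nonneg _).trans (hK 0 hb0)
  set B := 2 * C + 3 * N with hB
  have hB0 : 0 ≤ B := by positivity
  have hgrad : ∀ z ∈ ball (0 : ℂ) 1,
      ‖fderiv ℝ f z‖ ≤ (24 * B + γ + K) * (W (1 - ‖z‖) / (1 - ‖z‖)) := by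
    intro z hz
    have hz1 := mem_ball_zero_iff.1 hz
    set d := 1 - ‖z‖ with hd
    have hd0 : 0 < d := by linarith
    have hd1 : d ≤ 1 := by linarith [norm_nonneg z]
    have hsub : ∀ w ∈ ball z (d / 2), w ∈ ball (0 : ℂ) 1 ∧ 1 - ‖w‖ ≤ 2 * d ∧ ‖w - z‖ ≤ 2 * d := by
      intro w hw
      rw [mem_ball_iff_norm] at hw
      have h1 := norm_le_norm_add_norm_sub' w z
      have h2 := norm_le_norm_add_norm_sub' z w
      rw [norm_sub_rev z w] at h2
      refine ⟨mem_ball_zero_iff.2 ?_, ?_, ?_⟩ <;> linarith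
    -- On the ball of radius `d/2` the comparison through the boundary, with `L = 2d`, bounds the
    -- oscillation by a multiple of `W d`; the interior estimate with `s = d/4` then bounds the
    -- gradient.
    have hosc : ∀ w ∈ ball z (d / 2), ‖f w - f z‖ ≤ B * (2 * W d) := fun w hw => by
      obtain ⟨h1, h2, h3⟩ := hsub w hw
      refine (norm_sub_le_of_boundary hW hC hN hf hψ h1 hz h2 (by linarith) h3).trans ?_
      exact mul_le_mul_of_nonneg_left (hW.map_mul_le one_le_two hd0.le) hB0
    have h1 := norm_dZ_le (s := d / 4) (by positivity) (by linarith)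
      (hfd.mono fun w hw => (hsub w hw).1) hosc fun w hw => hγ w (hsub w hw).1
    have hq : 1 ≤ W d / d := by rw [le_div_iff₀ hd0]; linarith [hWt d hd0.le]
    have h2 : γ * (d / 4) ^ 3 ≤ γ * (W d / d) := by
      have : (d / 4) ^ 3 ≤ 1 := pow_le_one₀ (by positivity) (by linarith)
      gcongr
      linarith
    have h3 : K ≤ K * (W d / d) := by nlinarith
    have h4 : 3 * (B * (2 * W d)) / (d / 4) = 24 * B * (W d / d) := by
      field_simp
      ring
    rw [h4] at h1
    have := norm_fderiv_le f z
    have := hK z hz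
    linarith
  set G := 24 * B + γ + K with hG
  have hG0 : 0 ≤ G := by positivity
  refine ⟨G + 5 * B, by positivity, fun z₁ h₁ z₂ h₂ => ?_⟩
  have hW0 : 0 ≤ W ‖z₁ - z₂‖ := hW.nonneg (norm_nonneg _)
  rcases eq_or_ne z₁ z₂ with rfl | hne
  · simp [hW.map_zero]
  have hδ : 0 < ‖z₁ - z₂‖ := norm_pos_iff.2 (sub_ne_zero.2 hne)
  set δ := ‖z₁ - z₂‖ with hδe
  -- If `δ` is small relative to `1-|z₁|`, every point of the ball about `z₁` has distance at least
  -- `δ` to the circle, so monotonicity of `W(t)/t` bounds the gradient by `G W(δ)/δ`. Otherwise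
  -- `1-|z₁| < 4δ` and `1-|z₂| < 5δ`, so the comparison through the boundary applies with `L = 5δ`.
  rcases le_or_gt δ ((1 - ‖z₁‖) / 4) with hcase | hcase
  · have hmem : ∀ w ∈ closedBall z₁ δ, w ∈ ball (0 : ℂ) 1 ∧ δ ≤ 1 - ‖w‖ := by
      intro w hw
      rw [mem_closedBall_iff_norm] at hw
      have h1 := norm_le_norm_add_norm_sub' w z₁
      refine ⟨mem_ball_zero_iff.2 ?_, ?_⟩ <;> linarith
    have hbound : ∀ w ∈ closedBall z₁ δ, ‖fderiv ℝ f w‖ ≤ G * (W δ / δ) := fun w hw => by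
      obtain ⟨hw1, hw2⟩ := hmem w hw
      refine (hgrad w hw1).trans (mul_le_mul_of_nonneg_left ?_ hG0)
      exact hW.antitoneOn_div hδ (hδ.trans_le hw2) hw2
    have h := (convex_closedBall z₁ δ).norm_image_sub_le_of_norm_fderiv_le (𝕜 := ℝ)
      (fun w hw => (hfd.differentiableOn (by norm_num)).differentiableAt
        (isOpen_ball.mem_nhds (hmem w hw).1)) hbound
      (show z₂ ∈ closedBall z₁ δ by rw [mem_closedBall_iff_norm, norm_sub_rev])
      (mem_closedBall_self hδ.le)
    rw [← hδe, mul_assoc, div_mul_cancel₀ _ hδ.ne'] at h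
    nlinarith
  · have h1 := norm_le_norm_add_norm_sub' z₁ z₂
    have h := norm_sub_le_of_boundary hW hC hN hf hψ (L := 5 * δ) h₁ h₂ (by linarith)
      (by linarith) (by linarith)
    have h3 := mul_le_mul_of_nonneg_left (hW.map_mul_le (c := 5) (by norm_num) hδ.le) hB0
    nlinarith

end BiharmonicDirichlet

/-! ### The theorem -/

theorem theorem1 (ω₁ ω₂ : ℝ → ℝ)
    (hω₁ : BiharmonicDirichlet.IsMajorant ω₁) (hω₂ : BiharmonicDirichlet.IsMajorant ω₂)
    (hne : (∃ t : ℝ, 0 < t ∧ ω₁ t ≠ 0) ∨ (∃ t : ℝ, 0 < t ∧ ω₂ t ≠ 0))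
    (hHL : BiharmonicDirichlet.HardyLittlewoodCondition ω₂)
    (g φ ψ f : ℂ → ℂ)
    (hg : ContinuousOn g (Metric.closedBall (0 : ℂ) 1))
    (hφ : BiharmonicDirichlet.MemLipschitzSpace ω₁ (Metric.sphere (0 : ℂ) 1) φ)
    (hψ : BiharmonicDirichlet.MemLipschitzSpace ω₂ (Metric.sphere (0 : ℂ) 1) ψ)
    (hf : BiharmonicDirichlet.IsSolution g φ ψ f) :
    ∃ M : ℝ, 0 < M ∧ ∀ z₁ ∈ Metric.ball (0 : ℂ) 1, ∀ z₂ ∈ Metric.ball (0 : ℂ) 1,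
      ‖f z₁ - f z₂‖ ≤ M * ω₁ ‖z₁ - z₂‖ + M * ω₂ ‖z₁ - z₂‖ := by
  open BiharmonicDirichlet Metric Set in
  have hfd := hf.contDiffOn
  obtain ⟨G, hG⟩ := (isCompact_closedBall (0 : ℂ) 1).exists_bound_of_continuousOn hg
  have hγ : ∀ z ∈ ball (0 : ℂ) 1, ‖dZBar (dZ (dZBar (dZ f))) z‖ ≤ G / 16 := fun z hz => by
    have h := hG z (ball_subset_closedBall hz)
    rw [← hf.equation z hz, bilaplacian_eq_dZBar_dZ isOpen_ball hfd hz, norm_mul,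
      Complex.norm_ofNat] at h
    linarith
  have hγ' : ∀ z ∈ ball (0 : ℂ) 1, ‖dZ (dZ (dZBar (dZBar f))) z‖ ≤ G / 16 := fun z hz => by
    rw [dZ_dZ_dZBar_dZBar isOpen_ball hfd hz]
    exact hγ z hz
  obtain ⟨K, hK⟩ := hf.boundary_dZBar.exists_norm_le
    (contDiffOn_dZBar (m := 0) isOpen_ball hfd (by norm_num)).continuousOn
  obtain ⟨A, hA⟩ := hf.boundary_value.exists_norm_le hfd.continuousOn
  obtain ⟨C, hC, hbd⟩ := exists_norm_sub_boundary_le hω₂ hHL hψ hfd hγ' hK hA hf.boundary_value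
  obtain ⟨N, hN, hψN⟩ := hψ
  obtain ⟨M, hM, hLip⟩ := exists_lipschitz_of_boundary (W := fun t => ω₂ t + t) hω₂.add_id
    (fun t ht => by linarith [hω₂.nonneg ht]) hC.le hN.le hfd hγ hK hbd
    (fun ζ₁ h₁ ζ₂ h₂ => (hψN ζ₁ h₁ ζ₂ h₂).trans (by
      gcongr
      linarith [norm_nonneg (ζ₁ - ζ₂)]))
  -- This absorbs the linear term of `W(t) = ω₂(t) + t`; the range `[0, 2]` suffices because the
  -- disk has diameter 2.
  have hlow : ∃ c : ℝ, 0 < c ∧ ∀ t, 0 ≤ t → t ≤ 2 → t ≤ c * (ω₁ t + ω₂ t) := by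
    rcases hne with h | h
    · obtain ⟨c, hc, hct⟩ := hω₁.exists_mul_le h
      exact ⟨c, hc, fun t h0 h2 => (hct t h0 h2).trans (by
        gcongr; linarith [hω₂.nonneg h0])⟩
    · obtain ⟨c, hc, hct⟩ := hω₂.exists_mul_le h
      exact ⟨c, hc, fun t h0 h2 => (hct t h0 h2).trans (by
        gcongr; linarith [hω₁.nonneg h0])⟩
  obtain ⟨c, hc, hct⟩ := hlow
  refine ⟨(M + 1) * (1 + c), by positivity, fun z₁ h₁ z₂ h₂ => ?_⟩
  have h2 : ‖z₁ - z₂‖ ≤ 2 := (norm_sub_le _ _).trans (by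
    linarith [mem_ball_zero_iff.1 h₁, mem_ball_zero_iff.1 h₂])
  have h0 := norm_nonneg (z₁ - z₂)
  have hlt := hct _ h0 h2
  have n₁ := hω₁.nonneg h0
  have n₂ := hω₂.nonneg h0
  calc ‖f z₁ - f z₂‖ ≤ M * (ω₂ ‖z₁ - z₂‖ + ‖z₁ - z₂‖) := hLip z₁ h₁ z₂ h₂
    _ ≤ (M + 1) * ((ω₁ ‖z₁ - z₂‖ + ω₂ ‖z₁ - z₂‖) + c * (ω₁ ‖z₁ - z₂‖ + ω₂ ‖z₁ - z₂‖)) := by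
      gcongr <;> linarith
    _ = _ := by ring
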